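/- Throughout, a mixed graph on a set of nodes $V$ may have edges $a\to b$, $a\leftarrow b$, $a\leftrightarrow b$ and $a - b$; each edge has at each of its two ends a mark, an arrowhead or a tail, and $*$ stands for either mark. An edge $a *\!\!\to b$ has an arrowhead at $b$; an edge $a -\!\!* b$ has a tail at $a$. Two nodes are adjacent if there is an edge between them. A walk is a finite alternating sequence $\langle v_0,e_1,v_1,\dots,e_n,v_n\rangle$, $n\ge 0$, of nodes and edges with $e_i$ between $v_{i-1}$ and $v_i$; it is a path if no node occurs twice. An interior position $v_k$ of a walk is a collider if $v_{k-1} *\!\!\to v_k \leftarrow\!\!* v_{k+1}$ on the walk; all other positions, including the endpoints, are non-colliders. A node $a$ is an ancestor of $b$ if there is a directed walk $a\to\dots\to b$ with $n\ge0$ edges, and $\mathrm{Anc}(A)$ is the set of all ancestors of nodes of $A$. A walk is inducing if each of its nodes other than the endpoints is a collider and an ancestor of one of the endpoints. A mixed graph is a $\sigma$-MAG if (i) there is at most one edge between any two distinct nodes and no node is adjacent to itself; (ii) whenever there is a path $a -\!\!* \cdots -\!\!* b$, there is no edge $a \leftarrow\!\!* b$; (iii) there is no inducing path between two distinct non-adjacent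 nodes; (iv) if $a *\!\!\to b - c$, then $a$ and $c$ are adjacent, and if moreover $b - d$ with $d\ne c$, then $c$ and $d$ are adjacent. A walk is $m$-blocked by $Z\subseteq V$ if some non-collider on it is in $Z$, or some collider on it is not in $\mathrm{Anc}(Z)$, or it has a subwalk $v_{k-1} *\!\!\to v_k - v_{k+1}$ or $v_{k-1} - v_k \leftarrow\!\!* v_{k+1}$. For $X,Y,Z\subseteq V$, $X$ is $m$-separated from $Y$ given $Z$ if every walk from a node in $X$ to a node in $Y$ is $m$-blocked by $Z$. Two $\sigma$-MAGs on the same nodes $V$ are $m$-Markov equivalent if for all $X,Y,Z\subseteq V$, $X$ is $m$-separated from $Y$ given $Z$ in the one if and only if this is so in the other. An unshielded collider is a triple $(a,b,c)$ of distinct nodes with $a *\!\!\to b \leftarrow\!\!* c$ and $a$, $c$ non-adjacent. A discriminating path for $b$ is a path $(a,v_0,\dots,v_n,b,c)$, $n\ge 0$, such that $a$ and $c$ are not adjacent and each of $v_0,\dots,v_n$ is a collider on the path and a parent of $c$ (that is, $v_k\to c$). **Theorem.** Two $\sigma$-MAGs $\mathcal H_1,\mathcal H_2$ with the same nodes $V$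 are $m$-Markov equivalent if and only if all three of the following hold: 1. $\mathcal H_1$ and $\mathcal H_2$ have the same adjacencies. 2. $\mathcal H_1$ and $\mathcal H_2$ have the same unshielded colliders. 3. If $\pi$ is a discriminating path for $b$ in $\mathcal H_1$ and the path $\pi'$ in $\mathcal H_2$ with the same sequence of nodes is a discriminating path for $b$ in $\mathcal H_2$, then $b$ is a collider on $\pi$ in $\mathcal H_1$ if and only if $b$ is a collider on $\pi'$ in $\mathcal H_2$. -/

import Mathlib

/-- An edge mark. -/
inductive EdgeMark where
  | tail
  | head

/-- A mixed graph on `V` with edges of the types `→`, `←`, `↔`, `—`.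
`edge a s t b` says that there is an edge between `a` and `b` with mark `s` at `a` and mark `t`
at `b`: `edge a tail head b` is `a → b`, `edge a head tail b` is `a ← b`,
`edge a head head b` is `a ↔ b`, and `edge a tail tail b` is `a — b`. -/
structure MixedGraph (V : Type*) where
  edge : V → EdgeMark → EdgeMark → V → Prop
  symm : ∀ a s t b, edge a s t b → edge b t s a

namespace MixedGraph

variable {V : Type*}

/-- `a → b`. -/
def Directed (H : MixedGraph V) (a b : V) : Prop := H.edge a .tail .head b

/-- `a — b`. -/
def Undirected (H : MixedGraph V) (a b : V) : Prop := H.edge a .tail .tail b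

/-- `a *→ b`: an edge between `a` and `b` that is into `b`. -/
def Into (H : MixedGraph V) (a b : V) : Prop := ∃ s, H.edge a s .head b

/-- `a —* b`: an edge between `a` and `b` that is out of `a`. -/
def OutOf (H : MixedGraph V) (a b : V) : Prop := ∃ t, H.edge a .tail t b

/-- There is an edge, of any type, between `a` and `b`. -/
def Adj (H : MixedGraph V) (a b : V) : Prop := ∃ s t, H.edge a s t b

/-- A walk `⟨v₀, e₁, v₁, …, eₙ, vₙ⟩` with `n = len ≥ 0` edges, where `vₖ = node k` for `k ≤ len`
and where, for `k < len`, the edge between `vₖ` and `vₖ₊₁` has mark `left k` at `vₖ` and mark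
`right k` at `vₖ₊₁`. The values of the three functions outside these ranges are irrelevant. -/
structure Walk (H : MixedGraph V) where
  len : ℕ
  node : ℕ → V
  left : ℕ → EdgeMark
  right : ℕ → EdgeMark
  isEdge : ∀ k, k < len → H.edge (node k) (left k) (right k) (node (k + 1))

namespace Walk

variable {H : MixedGraph V}

/-- The first node of a walk. -/
def start (π : H.Walk) : V := π.node 0

/-- The last node of a walk. -/
def finish (π : H.Walk) : V := π.node π.len

/-- No node appears more than once on the walk. -/
def IsPath (π : H.Walk) : Prop :=
  ∀ i j, i ≤ π.len → j ≤ π.len → π.node i = π.node j → i = j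

/-- All edges point forward: `v₀ → v₁ → ⋯ → vₙ`. -/
def IsDirected (π : H.Walk) : Prop :=
  ∀ k, k < π.len → π.left k = .tail ∧ π.right k = .head

/-- All edges are out of their first node: `v₀ —* v₁ —* ⋯ —* vₙ`. -/
def IsAnterior (π : H.Walk) : Prop :=
  ∀ k, k < π.len → π.left k = .tail

/-- `vₖ` is an interior node of the walk and `vₖ₋₁ *→ vₖ ←* vₖ₊₁` on it. -/
def IsCollider (π : H.Walk) (k : ℕ) : Prop :=
  0 < k ∧ k < π.len ∧ π.right (k - 1) = .head ∧ π.left k = .head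

/-- `vₖ` is an endpoint of the walk, or `vₖ₋₁ *—* vₖ —* vₖ₊₁` or `vₖ₋₁ *— vₖ *—* vₖ₊₁` on it. -/
def IsNonCollider (π : H.Walk) (k : ℕ) : Prop :=
  k = 0 ∨ k = π.len ∨
    (0 < k ∧ k < π.len ∧ (π.left k = .tail ∨ π.right (k - 1) = .tail))

/-- The walk has a subwalk `vₖ₋₁ *→ vₖ — vₖ₊₁` or `vₖ₋₁ — vₖ ←* vₖ₊₁`. -/
def HasArrowheadAtUndirected (π : H.Walk) : Prop :=
  ∃ k, 0 < k ∧ k < π.len ∧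
    ((π.right (k - 1) = .head ∧ π.left k = .tail ∧ π.right k = .tail) ∨
      (π.left (k - 1) = .tail ∧ π.right (k - 1) = .tail ∧ π.left k = .head))

end Walk

/-- The set of ancestors of a node. -/
def Anc (H : MixedGraph V) (b : V) : Set V :=
  {a | ∃ π : H.Walk, π.IsDirected ∧ π.start = a ∧ π.finish = b}

/-- The set of ancestors of a set of nodes. -/
def AncSet (H : MixedGraph V) (A : Set V) : Set V := ⋃ v ∈ A, H.Anc v

/-- Every node of the walk, except for the endpoints, is a collider and an ancestor of an
endpoint. -/
def Walk.IsInducing {H : MixedGraph V} (π : H.Walk) : Prop :=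
  ∀ k, 0 < k → k < π.len → π.IsCollider k ∧ π.node k ∈ H.AncSet {π.start, π.finish}

/-- Between two distinct nodes there is at most one edge, and no node is adjacent to itself. -/
def IsSimple (H : MixedGraph V) : Prop :=
  (∀ a b s t s' t', a ≠ b → H.edge a s t b → H.edge a s' t' b → s = s' ∧ t = t') ∧
    ∀ a, ¬ H.Adj a a

/-- If there is an anterior path from `a` to `b`, then there is no edge `a ←* b`. -/
def IsAncestral (H : MixedGraph V) : Prop :=
  ∀ π : H.Walk, π.IsPath → π.IsAnterior → ¬ H.Into π.finish π.start

/-- There is no inducing path between distinct non-adjacent nodes. -/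
def IsMaximal (H : MixedGraph V) : Prop :=
  ∀ a b, a ≠ b → ¬ H.Adj a b →
    ¬ ∃ π : H.Walk, π.IsPath ∧ π.IsInducing ∧ π.start = a ∧ π.finish = b

/-- If `a *→ b — c`, then `a` and `c` are adjacent and, for every further node `d` with `b — d`,
also `c` and `d` are adjacent. -/
def IsSigmaComplete (H : MixedGraph V) : Prop :=
  ∀ a b c, H.Into a b → H.Undirected b c →
    H.Adj a c ∧ ∀ d, d ≠ c → H.Undirected b d → H.Adj c d

/-- σ-maximal ancestral graphs. -/
structure IsSigmaMAG (H : MixedGraph V) : Prop where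
  simple : H.IsSimple
  ancestral : H.IsAncestral
  maximal : H.IsMaximal
  sigmaComplete : H.IsSigmaComplete

/-- The walk `π` is m-blocked by `Z`. -/
def Walk.IsMBlocked {H : MixedGraph V} (π : H.Walk) (Z : Set V) : Prop :=
  (∃ k, k ≤ π.len ∧ π.IsNonCollider k ∧ π.node k ∈ Z) ∨
    (∃ k, k ≤ π.len ∧ π.IsCollider k ∧ π.node k ∉ H.AncSet Z) ∨
    π.HasArrowheadAtUndirected

/-- `X` is m-separated from `Y` given `Z`. -/
def MSeparated (H : MixedGraph V) (X Y Z : Set V) : Prop :=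
  ∀ π : H.Walk, π.start ∈ X → π.finish ∈ Y → π.IsMBlocked Z

/-- Both graphs have the same m-separations. -/
def MMarkovEquivalent (H₁ H₂ : MixedGraph V) : Prop :=
  ∀ X Y Z : Set V, H₁.MSeparated X Y Z ↔ H₂.MSeparated X Y Z

/-- The triple `(a, b, c)` of distinct nodes is unshielded. -/
def IsUnshielded (H : MixedGraph V) (a b c : V) : Prop :=
  a ≠ b ∧ b ≠ c ∧ a ≠ c ∧ H.Adj b a ∧ H.Adj b c ∧ ¬ H.Adj a c

/-- The triple `(a, b, c)` is unshielded and `a *→ b ←* c`. -/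
def IsUnshieldedCollider (H : MixedGraph V) (a b c : V) : Prop :=
  H.IsUnshielded a b c ∧ H.Into a b ∧ H.Into c b

/-- `π` is a path `(a, v₀, …, vₙ, b, c)`, `n ≥ 0`, such that `a` and `c` are not adjacent and each
`vₖ` is a collider on `π` and a parent of `c`: a discriminating path for `b`. The nodes `a`, `b`,
`c` have the positions `0`, `π.len - 1`, `π.len`, and `v₀, …, vₙ` the positions strictly between
those of `a` and `b`. -/
def Walk.IsDiscriminating {H : MixedGraph V} (π : H.Walk) : Prop :=
  3 ≤ π.len ∧ π.IsPath ∧ ¬ H.Adj π.start π.finish ∧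
    ∀ k, 0 < k → k < π.len - 1 → π.IsCollider k ∧ H.Directed (π.node k) π.finish

/-- Two walks, in two graphs on the same nodes, with the same sequence of nodes. -/
def Walk.Corresponds {H₁ H₂ : MixedGraph V} (π₁ : H₁.Walk) (π₂ : H₂.Walk) : Prop :=
  π₁.len = π₂.len ∧ ∀ k, k ≤ π₁.len → π₁.node k = π₂.node k

/-- The two graphs have the same adjacencies. -/
def SameAdjacencies (H₁ H₂ : MixedGraph V) : Prop :=
  ∀ a b, H₁.Adj a b ↔ H₂.Adj a b

/-- The two graphs have the same unshielded colliders. -/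
def SameUnshieldedColliders (H₁ H₂ : MixedGraph V) : Prop :=
  ∀ a b c, H₁.IsUnshieldedCollider a b c ↔ H₂.IsUnshieldedCollider a b c

/-- If corresponding paths are discriminating in both graphs, then the discriminated node is a
collider on the one if and only if it is a collider on the other. -/
def SameDiscriminatedColliders (H₁ H₂ : MixedGraph V) : Prop :=
  ∀ (π₁ : H₁.Walk) (π₂ : H₂.Walk), π₁.Corresponds π₂ →
    π₁.IsDiscriminating → π₂.IsDiscriminating →
      (π₁.IsCollider (π₁.len - 1) ↔ π₂.IsCollider (π₂.len - 1))

end MixedGraph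

/-! In a σ-MAG the mark at `a` on an edge between `a` and `b` is a tail exactly when `a` is anterior
to `b`. Adjacency and anteriority therefore determine all edges, and an unblocked walk is just a
sequence of nodes (`IsSigmaMAG.mSeparated_iff`).

Necessity. Distinct non-adjacent nodes are separated by the other nodes anterior to one of them
(`IsSigmaMAG.exists_mSeparated`). This rests on `ColliderSeq.adj_ends`, which extends maximality
from inducing paths to collider walks with interior nodes anterior to an end. Hence separations
determine adjacencies. A set that avoids and separates the ends of an unshielded triple or a
discriminating path contains the middle or discriminated node exactly when that node is not a
collider (`IsSigmaMAG.mem_iff_of_mSeparated`), so separations also determine these colliders.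

Sufficiency. Among the shortest open walks between two nodes in one graph, take one minimising the
sum of the distances of its nodes to `Z`. A shortest open walk is a path, and each of its shielded
positions is discriminated by a piece of the walk itself (`IsShortest.discriminated`). Two positions
cannot discriminate across each other (`IsShortest.not_discriminated_cycle`), so the dependence is
well founded and the walk has the same colliders in the other graph (`Similar.sameAt`). Minimality
of the distances lets a directed path from each collider to `Z` be carried over
(`Similar.mem_ancSet`). The walk is thus open in the other graph, and the criterion is symmetric. -/

namespace MixedGraph

/-! ### Edge marks in terms of anteriority. -/

variable {V : Type*} {H : MixedGraph V}

/-- `a` is anterior to `b`: there is a walk `a —* ⋯ —* b`. -/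
def Ant (H : MixedGraph V) : V → V → Prop := Relation.ReflTransGen H.OutOf

theorem Ant.refl (a : V) : H.Ant a a := Relation.ReflTransGen.refl

theorem Ant.trans {a b c : V} (h : H.Ant a b) (h' : H.Ant b c) : H.Ant a c :=
  Relation.ReflTransGen.trans h h'

theorem Adj.symm {a b : V} (h : H.Adj a b) : H.Adj b a := by
  obtain ⟨s, t, h⟩ := h
  exact ⟨t, s, H.symm _ _ _ _ h⟩

theorem Into.adj {a b : V} (h : H.Into a b) : H.Adj a b := by
  obtain ⟨s, h⟩ := h
  exact ⟨s, _, h⟩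

theorem Ant.exists_path {a b : V} (h : H.Ant a b) :
    ∃ (n : ℕ) (g : ℕ → V), g 0 = a ∧ g n = b ∧ (∀ k, k < n → H.OutOf (g k) (g (k + 1))) ∧
      ∀ i j, i ≤ n → j ≤ n → g i = g j → i = j := by
  induction h using Relation.ReflTransGen.head_induction_on with
  | refl => exact ⟨0, fun _ => b, rfl, rfl, by simp, by intros; omega⟩
  | @head a c hac _ ih =>
    obtain ⟨n, g, h0, hn, hg, hinj⟩ := ih
    by_cases hex : ∃ m, m ≤ n ∧ g m = a
    · obtain ⟨m, hm, hma⟩ := hex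
      refine ⟨n - m, fun k => g (m + k), by simpa using hma, ?_, ?_, ?_⟩
      · simp only [show m + (n - m) = n by omega, hn]
      · intro k hk
        exact hg (m + k) (by omega)
      · intro i j hi hj hij
        have := hinj (m + i) (m + j) (by omega) (by omega) hij
        omega
    · push Not at hex
      refine ⟨n + 1, fun k => if k = 0 then a else g (k - 1), by simp, by simpa using hn, ?_, ?_⟩
      · intro k hk
        rcases k with _ | k
        · simpa [h0] using hac
        · simpa using hg k (by omega)
      · intro i j hi hj hij
        rcases i with _ | i <;> rcases j with _ | j
        · rfl
        · simp only [if_true, Nat.add_one_ne_zero, if_false, Nat.add_sub_cancel] at hij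
          exact absurd hij.symm (hex j (by omega))
        · simp only [if_true, Nat.add_one_ne_zero, if_false, Nat.add_sub_cancel] at hij
          exact absurd hij (hex i (by omega))
        · simp only [Nat.add_one_ne_zero, if_false, Nat.add_sub_cancel] at hij
          have := hinj i j (by omega) (by omega) hij
          omega

namespace IsSigmaMAG

theorem not_into_of_ant (hH : H.IsSigmaMAG) {a b : V} (h : H.Ant a b) : ¬ H.Into b a := by
  have : Nonempty EdgeMark := ⟨.tail⟩
  obtain ⟨n, g, h0, hn, hg, hinj⟩ := h.exists_path
  choose! t ht using hg
  have := hH.ancestral ⟨n, g, fun _ => .tail, t, ht⟩ hinj (fun _ _ => rfl)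
  simpa [Walk.start, Walk.finish, h0, hn] using this

theorem into_iff (hH : H.IsSigmaMAG) {a b : V} : H.Into a b ↔ H.Adj a b ∧ ¬ H.Ant b a := by
  refine ⟨fun h => ⟨h.adj, fun h' => hH.not_into_of_ant h' h⟩, ?_⟩
  rintro ⟨⟨s, t, h⟩, hn⟩
  cases t
  · exact absurd (Relation.ReflTransGen.single ⟨s, H.symm _ _ _ _ h⟩) hn
  · exact ⟨s, h⟩

theorem mark_right (hH : H.IsSigmaMAG) {a b : V} {s t : EdgeMark} (h : H.edge a s t b) :
    t = .tail ↔ H.Ant b a := by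
  cases t
  · exact iff_of_true rfl (Relation.ReflTransGen.single ⟨s, H.symm _ _ _ _ h⟩)
  · simpa using fun h' => hH.not_into_of_ant h' ⟨s, h⟩

theorem mark_left (hH : H.IsSigmaMAG) {a b : V} {s t : EdgeMark} (h : H.edge a s t b) :
    s = .tail ↔ H.Ant a b := hH.mark_right (H.symm _ _ _ _ h)

/-- This is what allows later arguments to drop edge marks and work with `Adj` and `Ant` alone. -/
theorem edge_iff (hH : H.IsSigmaMAG) {a b : V} {s t : EdgeMark} :
    H.edge a s t b ↔ H.Adj a b ∧ (s = .tail ↔ H.Ant a b) ∧ (t = .tail ↔ H.Ant b a) := by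
  refine ⟨fun h => ⟨⟨s, t, h⟩, hH.mark_left h, hH.mark_right h⟩, ?_⟩
  rintro ⟨⟨s', t', h⟩, hs, ht⟩
  have hs' := hH.mark_left h
  have ht' := hH.mark_right h
  have h1 : s = s' := by cases s <;> cases s' <;> simp_all
  have h2 : t = t' := by cases t <;> cases t' <;> simp_all
  rwa [h1, h2]

theorem directed_iff (hH : H.IsSigmaMAG) {a b : V} :
    H.Directed a b ↔ H.Adj a b ∧ H.Ant a b ∧ ¬ H.Ant b a := by
  simp [Directed, hH.edge_iff]

theorem undirected_iff (hH : H.IsSigmaMAG) {a b : V} :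
    H.Undirected a b ↔ H.Adj a b ∧ H.Ant a b ∧ H.Ant b a := by
  simp [Undirected, hH.edge_iff]

theorem ne_of_adj (hH : H.IsSigmaMAG) {a b : V} (h : H.Adj a b) : a ≠ b := by
  rintro rfl
  exact hH.simple.2 a h

/-- An edge into a node of an undirected edge is copied at the other end of that edge. -/
theorem adj_of_into (hH : H.IsSigmaMAG) {a b c : V} (hab : H.Adj a b) (hba : ¬ H.Ant b a)
    (hbc : H.Adj b c) (h : H.Ant b c) (h' : H.Ant c b) : H.Adj a c :=
  (hH.sigmaComplete a b c (hH.into_iff.2 ⟨hab, hba⟩) (hH.undirected_iff.2 ⟨hbc, h, h'⟩)).1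

theorem adj_of_undirected (hH : H.IsSigmaMAG) {a b c d : V} (hab : H.Adj a b) (hba : ¬ H.Ant b a)
    (hbc : H.Adj b c) (h : H.Ant b c) (h' : H.Ant c b) (hbd : H.Adj b d) (k : H.Ant b d)
    (k' : H.Ant d b) (hcd : c ≠ d) : H.Adj c d :=
  (hH.sigmaComplete a b c (hH.into_iff.2 ⟨hab, hba⟩) (hH.undirected_iff.2 ⟨hbc, h, h'⟩)).2 d
    hcd.symm (hH.undirected_iff.2 ⟨hbd, k, k'⟩)

end IsSigmaMAG

/-! ### Ancestors, and open walks as sequences of nodes. -/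

theorem mem_ancSet_of_mem {Z : Set V} {v : V} (h : v ∈ Z) : v ∈ H.AncSet Z := by
  simp only [AncSet, Set.mem_iUnion]
  exact ⟨v, h, ⟨0, fun _ => v, fun _ => .tail, fun _ => .tail, by simp⟩,
    by simp [Walk.IsDirected], rfl, rfl⟩

/-- There is a directed walk with `m` edges from `v` to a node of `Z`. -/
def Reaches (H : MixedGraph V) (Z : Set V) : ℕ → V → Prop
  | 0, v => v ∈ Z
  | m + 1, v => ∃ w, H.Directed v w ∧ Reaches H Z m w

theorem mem_ancSet_iff {Z : Set V} {v : V} : v ∈ H.AncSet Z ↔ ∃ m, H.Reaches Z m v := by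
  constructor
  · simp only [AncSet, Set.mem_iUnion]
    rintro ⟨z, hz, ⟨n, f, l, r, he⟩, hd, hs, hf⟩
    simp only [Walk.IsDirected, Walk.start, Walk.finish] at hd hs hf
    refine ⟨n, ?_⟩
    have key : ∀ j, j ≤ n → H.Reaches Z j (f (n - j)) := by
      intro j
      induction j with
      | zero => intro _; simpa [Reaches, hf] using hz
      | succ j ih =>
        intro hj
        refine ⟨f (n - j), ?_, ih (by omega)⟩
        have h1 := he (n - (j + 1)) (by omega)
        have h2 := hd (n - (j + 1)) (by omega)
        rw [h2.1, h2.2, show n - (j + 1) + 1 = n - j by omega] at h1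
        exact h1
    simpa [hs] using key n le_rfl
  · rintro ⟨m, hm⟩
    have key : ∀ m v, H.Reaches Z m v → ∃ z ∈ Z, ∃ f : ℕ → V, f 0 = v ∧ f m = z ∧
        ∀ k, k < m → H.Directed (f k) (f (k + 1)) := by
      intro m
      induction m with
      | zero => exact fun v hv => ⟨v, hv, fun _ => v, rfl, rfl, by simp⟩
      | succ m ih =>
        rintro v ⟨w, hvw, hw⟩
        obtain ⟨z, hz, f, h0, hm, hf⟩ := ih w hw
        refine ⟨z, hz, fun k => if k = 0 then v else f (k - 1), by simp, by simpa using hm, ?_⟩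
        intro k hk
        rcases k with _ | k
        · simpa [h0] using hvw
        · simpa using hf k (by omega)
    obtain ⟨z, hz, f, h0, hm, hf⟩ := key m v hm
    simp only [AncSet, Set.mem_iUnion]
    exact ⟨z, hz, ⟨m, f, fun _ => .tail, fun _ => .head, hf⟩, fun _ _ => ⟨rfl, rfl⟩, h0, hm⟩

theorem mem_ancSet_of_directed {Z : Set V} {v w : V} (h : H.Directed v w)
    (hw : w ∈ H.AncSet Z) : v ∈ H.AncSet Z := by
  rw [mem_ancSet_iff] at hw ⊢
  obtain ⟨m, hm⟩ := hw
  exact ⟨m + 1, w, h, hm⟩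

theorem exists_ant_of_mem_ancSet {Z : Set V} {v : V} (h : v ∈ H.AncSet Z) :
    ∃ z ∈ Z, H.Ant v z := by
  obtain ⟨m, hm⟩ := mem_ancSet_iff.1 h
  clear h
  induction m generalizing v with
  | zero => exact ⟨v, hm, .refl v⟩
  | succ m ih =>
    obtain ⟨w, hvw, hw⟩ := hm
    obtain ⟨z, hz, hwz⟩ := ih hw
    exact ⟨z, hz, Relation.ReflTransGen.head ⟨_, hvw⟩ hwz⟩

/-- The position of `v` between `u` and `w` on a walk does not m-block the walk. -/
def TripleOpen (H : MixedGraph V) (Z : Set V) (u v w : V) : Prop :=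
  (¬ H.Ant v u ∧ ¬ H.Ant v w ∧ v ∈ H.AncSet Z) ∨
    (v ∉ Z ∧ (H.Ant v u ∧ H.Ant v w ∨ H.Ant v u ∧ ¬ H.Ant v w ∧ ¬ H.Ant u v ∨
      ¬ H.Ant v u ∧ H.Ant v w ∧ ¬ H.Ant w v))

theorem TripleOpen.symm {Z : Set V} {u v w : V} (h : H.TripleOpen Z u v w) :
    H.TripleOpen Z w v u := by
  unfold TripleOpen at *
  tauto

/-- The nodes `f 0, …, f n` form a walk no interior position of which m-blocks it. -/
def OpenSeq (H : MixedGraph V) (Z : Set V) (n : ℕ) (f : ℕ → V) : Prop :=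
  (∀ k, k < n → H.Adj (f k) (f (k + 1))) ∧
    ∀ k, k + 1 < n → H.TripleOpen Z (f k) (f (k + 1)) (f (k + 2))

/-- Marks are functions of the nodes, so walks may be replaced by node sequences. The endpoints are
non-colliders, hence block when they lie in `Z`; this is the role of the last two conditions. -/
theorem IsSigmaMAG.mSeparated_iff (hH : H.IsSigmaMAG) {X Y Z : Set V} :
    H.MSeparated X Y Z ↔
      ∀ n f, H.OpenSeq Z n f → f 0 ∈ X → f n ∈ Y → f 0 ∉ Z → f n ∈ Z := by
  classical
  have mark : ∀ s : EdgeMark, s = .head ↔ ¬ s = .tail := by intro s; cases s <;> simp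
  constructor
  · intro h n f hf h0 hn hz0
    by_contra hzn
    let π : H.Walk := ⟨n, f, fun k => if H.Ant (f k) (f (k + 1)) then .tail else .head,
      fun k => if H.Ant (f (k + 1)) (f k) then .tail else .head, fun k hk => by
        rw [hH.edge_iff]
        refine ⟨hf.1 k hk, ?_, ?_⟩ <;> split_ifs <;> simp_all⟩
    have hb := h π h0 hn
    have hl : ∀ k, π.left k = .tail ↔ H.Ant (f k) (f (k + 1)) := fun k => by
      simp only [π]; split_ifs <;> simp_all
    have hr : ∀ k, π.right k = .tail ↔ H.Ant (f (k + 1)) (f k) := fun k => by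
      simp only [π]; split_ifs <;> simp_all
    simp only [Walk.IsMBlocked, Walk.IsNonCollider, Walk.IsCollider, Walk.HasArrowheadAtUndirected,
      mark, hl, hr] at hb
    rcases hb with ⟨k, hk, hnc, hz⟩ | ⟨k, hk, ⟨h1, h2, h3, h4⟩, hz⟩ | ⟨k, h1, h2, h3⟩
    · rcases hnc with rfl | rfl | ⟨h1, h2, h3⟩
      · exact hz0 hz
      · exact hzn hz
      · obtain ⟨k, rfl⟩ : ∃ j, k = j + 1 := ⟨k - 1, by omega⟩
        have := hf.2 k h2
        simp only [TripleOpen, Nat.add_sub_cancel, π] at *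
        tauto
    · obtain ⟨k, rfl⟩ : ∃ j, k = j + 1 := ⟨k - 1, by omega⟩
      have := hf.2 k h2
      simp only [TripleOpen, Nat.add_sub_cancel, π] at *
      tauto
    · obtain ⟨k, rfl⟩ : ∃ j, k = j + 1 := ⟨k - 1, by omega⟩
      have := hf.2 k h2
      simp only [TripleOpen, Nat.add_sub_cancel, π] at *
      tauto
  · intro h π h0 hn
    by_contra hb
    have hl : ∀ k, k < π.len → (π.left k = .tail ↔ H.Ant (π.node k) (π.node (k + 1))) :=
      fun k hk => hH.mark_left (π.isEdge k hk)
    have hr : ∀ k, k < π.len → (π.right k = .tail ↔ H.Ant (π.node (k + 1)) (π.node k)) :=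
      fun k hk => hH.mark_right (π.isEdge k hk)
    simp only [Walk.IsMBlocked, Walk.IsNonCollider, Walk.IsCollider, Walk.HasArrowheadAtUndirected,
      mark, not_or, not_exists, not_and] at hb
    obtain ⟨hb1, hb2, hb3⟩ := hb
    refine hb1 π.len le_rfl (by simp)
      (h π.len π.node ⟨fun k hk => ⟨_, _, π.isEdge k hk⟩, ?_⟩ h0 hn (hb1 0 (by omega) (by simp)))
    intro k hk
    have a1 := hb1 (k + 1) (by omega)
    have a2 := hb2 (k + 1) (by omega)
    have a3 := hb3 (k + 1)
    have l0 := hl k (by omega)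
    have l1 := hl (k + 1) (by omega)
    have r0 := hr k (by omega)
    have r1 := hr (k + 1) (by omega)
    simp only [Nat.add_sub_cancel, l0, l1, r0, r1] at a1 a2 a3
    have e1 : k + 1 ≠ π.len := by omega
    have e2 : 0 < k + 1 := by omega
    simp only [e1, e2, hk, Nat.add_one_ne_zero, false_or, true_and, forall_const] at a1 a2 a3
    clear h hl hr hb1 hb2 hb3 mark h0 hn l0 l1 r0 r1
    unfold TripleOpen
    grind

theorem OpenSeq.adj {Z : Set V} {n : ℕ} {f : ℕ → V} (h : H.OpenSeq Z n f) {k : ℕ} (hk : 0 < k)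
    (hkn : k ≤ n) : H.Adj (f (k - 1)) (f k) := by
  obtain ⟨k, rfl⟩ : ∃ j, k = j + 1 := ⟨k - 1, by omega⟩
  exact h.1 k hkn

theorem OpenSeq.triple {Z : Set V} {n : ℕ} {f : ℕ → V} (h : H.OpenSeq Z n f) {k : ℕ} (hk : 0 < k)
    (hkn : k < n) : H.TripleOpen Z (f (k - 1)) (f k) (f (k + 1)) := by
  obtain ⟨k, rfl⟩ : ∃ j, k = j + 1 := ⟨k - 1, by omega⟩
  exact h.2 k hkn

theorem OpenSeq.take {Z : Set V} {n : ℕ} {f : ℕ → V} (h : H.OpenSeq Z n f) {m : ℕ}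
    (hm : m ≤ n) : H.OpenSeq Z m f :=
  ⟨fun k hk => h.1 k (by omega), fun k hk => h.2 k (by omega)⟩

theorem OpenSeq.drop {Z : Set V} {n : ℕ} {f : ℕ → V} (h : H.OpenSeq Z n f) (m : ℕ) :
    H.OpenSeq Z (n - m) (fun k => f (m + k)) :=
  ⟨fun k hk => h.1 (m + k) (by omega), fun k hk => h.2 (m + k) (by omega)⟩

theorem OpenSeq.reverse {Z : Set V} {n : ℕ} {f : ℕ → V} (h : H.OpenSeq Z n f) :
    H.OpenSeq Z n (fun k => f (n - k)) := by
  refine ⟨fun k hk => ?_, fun k hk => ?_⟩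
  · have := (h.1 (n - (k + 1)) (by omega)).symm
    rwa [show n - (k + 1) + 1 = n - k by omega] at this
  · have := (h.2 (n - (k + 2)) (by omega)).symm
    rwa [show n - (k + 2) + 1 = n - (k + 1) by omega,
      show n - (k + 2) + 2 = n - k by omega] at this

/-- Joining two walks by an edge. -/
theorem OpenSeq.glue {Z : Set V} {m n : ℕ} {f g : ℕ → V} (hf : H.OpenSeq Z m f)
    (hg : H.OpenSeq Z n g) (hadj : H.Adj (f m) (g 0))
    (hl : 0 < m → H.TripleOpen Z (f (m - 1)) (f m) (g 0))
    (hr : 0 < n → H.TripleOpen Z (f m) (g 0) (g 1)) :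
    H.OpenSeq Z (m + 1 + n) (fun k => if k ≤ m then f k else g (k - (m + 1))) := by
  refine ⟨fun k hk => ?_, fun k hk => ?_⟩
  · rcases lt_trichotomy k m with h | rfl | h
    · simpa [h.le, show k + 1 ≤ m by omega] using hf.1 k h
    · simpa using hadj
    · have := hg.1 (k - (m + 1)) (by omega)
      simpa [show ¬ k ≤ m by omega, show ¬ k + 1 ≤ m by omega,
        show k - (m + 1) + 1 = k + 1 - (m + 1) by omega] using this
  · rcases lt_trichotomy (k + 1) m with h | rfl | h
    · simpa [show k ≤ m by omega, h.le, show k + 2 ≤ m by omega] using hf.2 k h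
    · simpa using hl
    · obtain rfl | h : k = m ∨ m < k := by omega
      · have := hr (by omega)
        simpa [show k + 2 - (k + 1) = 1 by omega] using this
      · have := hg.2 (k - (m + 1)) (by omega)
        simpa [show ¬ k ≤ m by omega, show ¬ k + 1 ≤ m by omega, show ¬ k + 2 ≤ m by omega,
          show k - (m + 1) + 1 = k + 1 - (m + 1) by omega,
          show k - (m + 1) + 2 = k + 2 - (m + 1) by omega] using this

/-! ### Consequences of σ-completeness and maximality. -/

namespace IsSigmaMAG

theorem exists_walk (hH : H.IsSigmaMAG) {n : ℕ} {f : ℕ → V}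
    (hadj : ∀ k, k < n → H.Adj (f k) (f (k + 1))) :
    ∃ π : H.Walk, π.len = n ∧ π.node = f := by
  classical
  refine ⟨⟨n, f, fun k => if H.Ant (f k) (f (k + 1)) then .tail else .head,
      fun k => if H.Ant (f (k + 1)) (f k) then .tail else .head, fun k hk => ?_⟩, rfl, rfl⟩
  rw [hH.edge_iff]
  refine ⟨hadj k hk, ?_, ?_⟩ <;> split_ifs <;> simp_all

theorem isCollider_iff (hH : H.IsSigmaMAG) (π : H.Walk) {k : ℕ} (hk : 0 < k) (hkn : k < π.len) :
    π.IsCollider k ↔ ¬ H.Ant (π.node k) (π.node (k - 1)) ∧ ¬ H.Ant (π.node k) (π.node (k + 1)) := by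
  have mark : ∀ s : EdgeMark, s = .head ↔ ¬ s = .tail := by intro s; cases s <;> simp
  obtain ⟨k, rfl⟩ : ∃ j, k = j + 1 := ⟨k - 1, by omega⟩
  simp [Walk.IsCollider, mark, hkn, hH.mark_left (π.isEdge _ hkn),
    hH.mark_right (π.isEdge k (by omega))]

/-- An anterior walk from `v` to `w` with a way back consists of undirected edges. The edge into `v`
is copied at `v₁`, and σ-completeness at `v₁` then joins its two undirected neighbours `v` and `w`.
-/
theorem eq_or_adj (hH : H.IsSigmaMAG) {u v w : V} (huv : H.Adj u v) (hvu : ¬ H.Ant v u)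
    (hvw : H.Ant v w) (hwv : H.Ant w v) : v = w ∨ H.Adj v w := by
  induction hvw using Relation.ReflTransGen.head_induction_on generalizing u with
  | refl => exact .inl rfl
  | @head v v₁ h h' ih =>
    have hv1 : H.Ant v v₁ := .single h
    have h1v : H.Ant v₁ v := Ant.trans h' hwv
    have hadj : H.Adj v v₁ := by obtain ⟨t, h⟩ := h; exact ⟨_, t, h⟩
    have hu1 := hH.adj_of_into huv hvu hadj hv1 h1v
    have h1u : ¬ H.Ant v₁ u := fun h => hvu (hv1.trans h)
    rcases ih hu1 h1u (hwv.trans hv1) with rfl | h1w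
    · exact .inr hadj
    · by_cases e : v = w
      · exact .inl e
      · exact .inr (hH.adj_of_undirected hu1 h1u hadj.symm h1v hv1 h1w h' (hwv.trans hv1) e)

/-- An edge into `v` is copied at every node anterior to and posterior to `v`. -/
theorem adj_congr (hH : H.IsSigmaMAG) {u v w : V} (huv : H.Adj u v) (hvu : ¬ H.Ant v u)
    (hvw : H.Ant v w) (hwv : H.Ant w v) : H.Adj u w := by
  rcases hH.eq_or_adj huv hvu hvw hwv with rfl | h
  · exact huv
  · exact hH.adj_of_into huv hvu h hvw hwv

/-- Anteriority is upgraded to ancestry at the cost of moving within a class of mutually anterior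
nodes. An undirected first step stays in the class; a directed one goes into `v₁`, so `v` itself is
a parent of the node found for `v₁`. -/
theorem exists_mem_ancSet (hH : H.IsSigmaMAG) {A : Set V} {u v z : V} (huv : H.Adj u v)
    (hvu : ¬ H.Ant v u) (hvz : H.Ant v z) (hz : z ∈ A) :
    ∃ w, H.Ant v w ∧ H.Ant w v ∧ w ∈ H.AncSet A := by
  induction hvz using Relation.ReflTransGen.head_induction_on generalizing u with
  | refl => exact ⟨z, .refl z, .refl z, mem_ancSet_of_mem hz⟩
  | @head v v₁ h h' ih =>
    have hv1 : H.Ant v v₁ := .single h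
    have hadj : H.Adj v v₁ := by obtain ⟨t, h⟩ := h; exact ⟨_, t, h⟩
    by_cases h1v : H.Ant v₁ v
    · obtain ⟨w, h1, h2, h3⟩ := ih (hH.adj_of_into huv hvu hadj hv1 h1v)
        (fun h => hvu (hv1.trans h))
      exact ⟨w, hv1.trans h1, h2.trans h1v, h3⟩
    · obtain ⟨w, h1, h2, h3⟩ := ih hadj h1v
      refine ⟨v, .refl v, .refl v, mem_ancSet_of_directed (hH.directed_iff.2
        ⟨hH.adj_congr hadj h1v h1 h2, hv1.trans h1, fun h => h1v (h1.trans h)⟩) h3⟩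

end IsSigmaMAG

/-- A walk from `a` to `c` whose interior positions are colliders and anterior to `a` or `c`. -/
structure ColliderSeq (H : MixedGraph V) (a c : V) (n : ℕ) (f : ℕ → V) : Prop where
  first : f 0 = a
  last : f n = c
  adj : ∀ k, k < n → H.Adj (f k) (f (k + 1))
  left : ∀ k, k + 1 < n → ¬ H.Ant (f (k + 1)) (f k)
  right : ∀ k, 0 < k → k < n → ¬ H.Ant (f k) (f (k + 1))
  ant : ∀ k, 0 < k → k < n → H.Ant (f k) a ∨ H.Ant (f k) c

namespace ColliderSeq

variable {a c : V} {n : ℕ} {f : ℕ → V}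

theorem reverse (h : H.ColliderSeq a c n f) : H.ColliderSeq c a n (fun k => f (n - k)) where
  first := by simpa using h.last
  last := by simpa using h.first
  adj k hk := by
    have := (h.adj (n - (k + 1)) (by omega)).symm
    rwa [show n - (k + 1) + 1 = n - k by omega] at this
  left k hk := by
    have := h.right (n - (k + 1)) (by omega) (by omega)
    rwa [show n - (k + 1) + 1 = n - k by omega] at this
  right k hk hkn := by
    have := h.left (n - (k + 1)) (by omega)
    rwa [show n - (k + 1) + 1 = n - k by omega] at this
  ant k hk hkn := (h.ant (n - k) (by omega) (by omega)).symm

/-- The edge between `f (i + 1)` and `f i` is copied at `a`, so everything from `a` to `f i`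
collapses to `a`. -/
theorem exists_lt_of_ant_first (hH : H.IsSigmaMAG) (h : H.ColliderSeq a c n f) {i : ℕ}
    (hi : 0 < i) (hin : i < n) (hai : H.Ant a (f i)) (hia : H.Ant (f i) a) :
    ∃ m g, m < n ∧ H.ColliderSeq a c m g := by
  refine ⟨n - i, fun k => if k = 0 then a else f (i + k), by omega, by simp, ?_, ?_, ?_, ?_, ?_⟩
  · simp [show n - i ≠ 0 by omega, show i + (n - i) = n by omega, h.last]
  · rintro (_ | k) hk
    · simpa using (hH.adj_congr (h.adj i hin).symm (h.right i hi hin) hia hai).symm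
    · simpa [add_assoc] using h.adj (i + (k + 1)) (by omega)
  · rintro (_ | k) hk
    · simpa using fun h' => h.left i (by omega) (h'.trans hai)
    · simpa [add_assoc] using h.left (i + (k + 1)) (by omega)
  · intro k hk hkn
    simpa [hk.ne', add_assoc] using h.right (i + k) (by omega) (by omega)
  · intro k hk hkn
    simpa [hk.ne'] using h.ant (i + k) (by omega) (by omega)

theorem exists_lt_of_ant_last (hH : H.IsSigmaMAG) (h : H.ColliderSeq a c n f) {i : ℕ}
    (hi : 0 < i) (hin : i < n) (hci : H.Ant c (f i)) (hic : H.Ant (f i) c) :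
    ∃ m g, m < n ∧ H.ColliderSeq a c m g := by
  obtain ⟨m, g, hm, hg⟩ := h.reverse.exists_lt_of_ant_first hH (i := n - i) (by omega) (by omega)
    (by rwa [show n - (n - i) = i by omega]) (by rwa [show n - (n - i) = i by omega])
  exact ⟨m, _, hm, hg.reverse⟩

/-- The loop can be cut out; when the repeated node is an endpoint, the two collapses above do this.
-/
theorem exists_lt_of_eq (hH : H.IsSigmaMAG) (h : H.ColliderSeq a c n f) (hac : a ≠ c) {i j : ℕ}
    (hij : i < j) (hj : j ≤ n) (e : f i = f j) : ∃ m g, m < n ∧ H.ColliderSeq a c m g := by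
  rcases Nat.eq_zero_or_pos i with rfl | hi
  · have hja : f j = a := by rw [← e, h.first]
    obtain rfl | hjn := hj.eq_or_lt
    · exact absurd (hja.symm.trans h.last) hac
    · exact h.exists_lt_of_ant_first hH hij hjn (by rw [hja]; exact .refl a)
        (by rw [hja]; exact .refl a)
  · obtain rfl | hjn := hj.eq_or_lt
    · have hic : f i = c := by rw [e, h.last]
      exact h.exists_lt_of_ant_last hH hi hij (by rw [hic]; exact .refl c)
        (by rw [hic]; exact .refl c)
    · refine ⟨n - (j - i), fun k => if k ≤ i then f k else f (k + (j - i)), by omega,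
        by simpa using h.first, ?_, ?_, ?_, ?_, ?_⟩
      · simp [show ¬ n - (j - i) ≤ i by omega, show n - (j - i) + (j - i) = n by omega, h.last]
      · intro k hk
        rcases lt_trichotomy k i with h1 | rfl | h1
        · simpa [h1.le, show k + 1 ≤ i by omega] using h.adj k (by omega)
        · simpa [e, show k + 1 + (j - k) = j + 1 by omega] using h.adj j hjn
        · simpa [show ¬ k ≤ i by omega, show ¬ k + 1 ≤ i by omega,
            show k + 1 + (j - i) = k + (j - i) + 1 by omega] using h.adj (k + (j - i)) (by omega)
      · intro k hk
        rcases lt_trichotomy k i with h1 | rfl | h1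
        · simpa [h1.le, show k + 1 ≤ i by omega] using h.left k (by omega)
        · simpa [e, show k + 1 + (j - k) = j + 1 by omega] using h.left j (by omega)
        · simpa [show ¬ k ≤ i by omega, show ¬ k + 1 ≤ i by omega,
            show k + 1 + (j - i) = k + (j - i) + 1 by omega] using h.left (k + (j - i)) (by omega)
      · intro k hk hkn
        rcases lt_trichotomy k i with h1 | rfl | h1
        · simpa [h1.le, show k + 1 ≤ i by omega] using h.right k hk (by omega)
        · simpa [e, show k + 1 + (j - k) = j + 1 by omega] using h.right j (by omega) hjn
        · simpa [show ¬ k ≤ i by omega, show ¬ k + 1 ≤ i by omega,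
            show k + 1 + (j - i) = k + (j - i) + 1 by omega]
            using h.right (k + (j - i)) (by omega) (by omega)
      · intro k hk hkn
        by_cases h1 : k ≤ i
        · simpa [h1] using h.ant k hk (by omega)
        · simpa [h1] using h.ant (k + (j - i)) (by omega) (by omega)

/-- Maximality extends from inducing paths to walks whose interior nodes are colliders that are
anterior to an endpoint. -/
theorem adj_ends (hH : H.IsSigmaMAG) (hac : a ≠ c) (h : H.ColliderSeq a c n f) : H.Adj a c := by
  induction n using Nat.strong_induction_on generalizing f with
  | _ n ih =>
  by_cases hlt : ∃ m g, m < n ∧ H.ColliderSeq a c m g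
  · obtain ⟨m, g, hm, hg⟩ := hlt
    exact ih m hm hg
  -- Each interior node is exchanged for a mutually anterior one that is an ancestor of an end.
  -- Since no shorter sequence exists, the new sequence is an inducing path.
  have hw : ∀ k, ∃ w, H.Ant (f k) w ∧ H.Ant w (f k) ∧
      (0 < k ∧ k < n → w ∈ H.AncSet {a, c}) ∧ (¬ (0 < k ∧ k < n) → w = f k) := by
    intro k
    by_cases hk : 0 < k ∧ k < n
    · have hadj := h.adj (k - 1) (by omega)
      have hl := h.left (k - 1) (by omega)
      rw [show k - 1 + 1 = k by omega] at hadj hl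
      have : ∃ z ∈ ({a, c} : Set V), H.Ant (f k) z := by
        rcases h.ant k hk.1 hk.2 with h | h
        · exact ⟨a, by simp, h⟩
        · exact ⟨c, by simp, h⟩
      obtain ⟨z, hz, hkz⟩ := this
      obtain ⟨w, h1, h2, h3⟩ := hH.exists_mem_ancSet hadj hl hkz hz
      exact ⟨w, h1, h2, fun _ => h3, fun h => absurd hk h⟩
    · exact ⟨f k, .refl _, .refl _, fun h => absurd h hk, fun _ => rfl⟩
  choose g hfg hgf hganc hgeq using hw
  have hg : H.ColliderSeq a c n g := by
    refine ⟨by rw [hgeq 0 (by omega), h.first], by rw [hgeq n (by omega), h.last], ?_, ?_, ?_, ?_⟩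
    · intro k hk
      have h1 : H.Adj (f k) (g (k + 1)) := by
        by_cases hk' : k + 1 < n
        · exact hH.adj_congr (h.adj k hk) (h.left k hk') (hfg _) (hgf _)
        · rw [hgeq (k + 1) (by omega)]
          exact h.adj k hk
      by_cases hk' : 0 < k
      · exact (hH.adj_congr h1.symm (fun h' => h.right k hk' hk (h'.trans (hgf _)))
          (hfg k) (hgf k)).symm
      · rwa [hgeq k (by omega)]
    · exact fun k hk h' => h.left k hk (((hfg _).trans h').trans (hgf _))
    · exact fun k hk hkn h' => h.right k hk hkn (((hfg _).trans h').trans (hgf _))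
    · exact fun k hk hkn => (h.ant k hk hkn).imp (hgf k).trans (hgf k).trans
  obtain ⟨π, hlen, hnode⟩ := hH.exists_walk hg.adj
  by_contra hnadj
  refine hH.maximal a c hac hnadj ⟨π, ?_, ?_, by simp [Walk.start, hnode, hg.first],
    by simp [Walk.finish, hlen, hnode, hg.last]⟩
  · intro i j hi hj e
    rw [hlen] at hi hj
    rw [hnode] at e
    rcases lt_trichotomy i j with hij | hij | hij
    · exact absurd (hg.exists_lt_of_eq hH hac hij hj e) hlt
    · exact hij
    · exact absurd (hg.exists_lt_of_eq hH hac hij hi e.symm) hlt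
  · intro k hk hkn
    rw [hH.isCollider_iff π hk hkn, Walk.start, Walk.finish, hnode, hlen, hg.first, hg.last]
    rw [hlen] at hkn
    refine ⟨⟨?_, hg.right k hk hkn⟩, hganc k ⟨hk, hkn⟩⟩
    have := hg.left (k - 1) (by omega)
    rwa [show k - 1 + 1 = k by omega] at this

end ColliderSeq

/-! ### Separating sets, and what they say about colliders. -/

/-- Tails are followed forward until they reach the end of the walk or a collider, which is an
ancestor of `Z`. -/
theorem OpenSeq.ant_of_ant_next {Z : Set V} {n : ℕ} {f : ℕ → V} {S : Set V}
    (hS : ∀ u v, H.Ant u v → v ∈ S → u ∈ S) (hZ : Z ⊆ S) (h : H.OpenSeq Z n f) (hn : f n ∈ S)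
    {k : ℕ} (hk : k < n) (hkk : H.Ant (f k) (f (k + 1))) : f k ∈ S := by
  obtain ⟨m, rfl⟩ : ∃ m, n = k + 1 + m := ⟨n - (k + 1), by omega⟩
  induction m generalizing k with
  | zero => exact hS _ _ hkk hn
  | succ m ih =>
    refine hS _ _ hkk ?_
    have ih' : H.Ant (f (k + 1)) (f (k + 2)) → f (k + 1) ∈ S := fun h' =>
      ih h' (by rwa [show k + 1 + 1 + m = k + 1 + (m + 1) by omega])
        (by rwa [show k + 1 + 1 + m = k + 1 + (m + 1) by omega]) (by omega)
    rcases h.2 k (by omega) with ⟨-, -, hz⟩ | ⟨-, h1 | h1 | h1⟩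
    · obtain ⟨z, hz, hz'⟩ := exists_ant_of_mem_ancSet hz
      exact hS _ _ hz' (hZ hz)
    · exact ih' h1.2
    · exact absurd hkk h1.2.2
    · exact ih' h1.2.1

theorem OpenSeq.mem_of_mem {Z : Set V} {n : ℕ} {f : ℕ → V} {S : Set V}
    (hS : ∀ u v, H.Ant u v → v ∈ S → u ∈ S) (hZ : Z ⊆ S) (h : H.OpenSeq Z n f) (h0 : f 0 ∈ S)
    (hn : f n ∈ S) {k : ℕ} (hk : k ≤ n) : f k ∈ S := by
  by_cases hk0 : k = 0
  · rwa [hk0]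
  by_cases hkn : k = n
  · rwa [hkn]
  have hright : H.Ant (f k) (f (k + 1)) → f k ∈ S := h.ant_of_ant_next hS hZ hn (by omega)
  have hleft : H.Ant (f k) (f (k - 1)) → f k ∈ S := by
    have := h.reverse.ant_of_ant_next hS hZ (by simpa using h0) (k := n - k) (by omega)
    rwa [show n - (n - k) = k by omega, show n - (n - k + 1) = k - 1 by omega] at this
  rcases h.triple (k := k) (by omega) (by omega) with ⟨-, -, hz⟩ | ⟨-, h1 | h1 | h1⟩
  · obtain ⟨z, hz, hz'⟩ := exists_ant_of_mem_ancSet hz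
    exact hS _ _ hz' (hZ hz)
  · exact hleft h1.1
  · exact hleft h1.1
  · exact hright h1.2.1

/-- Distinct non-adjacent nodes of a σ-MAG are m-separated by the other nodes that are anterior to
one of them. -/
theorem IsSigmaMAG.exists_mSeparated (hH : H.IsSigmaMAG) {a c : V} (hac : a ≠ c)
    (hadj : ¬ H.Adj a c) : ∃ Z : Set V, a ∉ Z ∧ c ∉ Z ∧ H.MSeparated {a} {c} Z := by
  let S : Set V := {v | H.Ant v a ∨ H.Ant v c}
  have hS : ∀ u v, H.Ant u v → v ∈ S → u ∈ S := fun u v huv hv => hv.imp huv.trans huv.trans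
  refine ⟨{v | v ∈ S ∧ v ≠ a ∧ v ≠ c}, by simp, by simp, hH.mSeparated_iff.2 ?_⟩
  intro n f hf h0 hn
  simp only [Set.mem_singleton_iff] at h0 hn
  exfalso
  induction n using Nat.strong_induction_on generalizing f with
  | _ n ih =>
  -- If an endpoint recurs inside, a shorter walk remains. Otherwise every interior node lies in the
  -- separating set, so each is a collider and `ColliderSeq.adj_ends` makes `a` and `c` adjacent.
  by_cases hi : ∃ i, 0 < i ∧ i < n ∧ (f i = a ∨ f i = c)
  · obtain ⟨i, hi, hin, e | e⟩ := hi
    · exact ih (n - i) (by omega) _ (hf.drop i) (by simpa using e)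
        (by simpa [show i + (n - i) = n by omega] using hn)
    · exact ih i hin f (hf.take hin.le) h0 e
  · push Not at hi
    refine hadj (ColliderSeq.adj_ends (n := n) (f := f) hH hac ?_)
    have hmem : ∀ k, k ≤ n → f k ∈ S := fun k hk =>
      hf.mem_of_mem hS (fun v hv => hv.1) (by simp [S, h0, Ant.refl]) (by simp [S, hn, Ant.refl]) hk
    have hcol : ∀ k, 0 < k → k < n → ¬ H.Ant (f k) (f (k - 1)) ∧ ¬ H.Ant (f k) (f (k + 1)) := by
      intro k hk hkn
      rcases hf.triple hk hkn with h | h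
      · exact ⟨h.1, h.2.1⟩
      · exact absurd ⟨hmem k hkn.le, hi k hk hkn⟩ h.1
    exact ⟨h0, hn, hf.1, fun k hk => (hcol (k + 1) (by omega) hk).1,
      fun k hk hkn => (hcol k hk hkn).2, fun k hk hkn => hmem k hkn.le⟩

/-- If `a = f 0` and `c = f n` are m-separated by `Z` and the nodes strictly between `f 0` and
`f (n - 1)` are colliders and parents of `c`, then `f (n - 1)` is in `Z` if and only if it is not a
collider. -/
theorem IsSigmaMAG.mem_iff_of_mSeparated (hH : H.IsSigmaMAG) {Z : Set V} {n : ℕ} {f : ℕ → V}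
    (hn : 2 ≤ n) (hadj : ∀ k, k < n → H.Adj (f k) (f (k + 1))) (hnadj : ¬ H.Adj (f 0) (f n))
    (h0 : f 0 ∉ Z) (hnZ : f n ∉ Z) (hsep : H.MSeparated {f 0} {f n} Z)
    (hcol : ∀ k, 0 < k → k < n - 1 → ¬ H.Ant (f k) (f (k - 1)) ∧ ¬ H.Ant (f k) (f (k + 1)) ∧
      H.Directed (f k) (f n)) :
    f (n - 1) ∈ Z ↔ ¬ (¬ H.Ant (f (n - 1)) (f (n - 2)) ∧ ¬ H.Ant (f (n - 1)) (f n)) := by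
  rw [hH.mSeparated_iff] at hsep
  -- The walk `f 0, …, f k, f n` is open at the colliders before `f k`, which are in `Z`; hence it
  -- must be blocked at `f k`.
  have key : ∀ k, 0 < k → k < n → (∀ i, 0 < i → i < k → f i ∈ Z) → H.Adj (f k) (f n) →
      ¬ H.TripleOpen Z (f (k - 1)) (f k) (f n) := by
    intro k hk hkn hZ hkadj hopen
    refine hnZ ?_
    have := hsep (k + 1) (fun i => if i ≤ k then f i else f n) ⟨?_, ?_⟩ (by simp) (by simp)
      (by simpa using h0)
    · simpa using this
    · intro i hi
      obtain rfl | h1 : i = k ∨ i < k := by omega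
      · simpa using hkadj
      · simpa [h1.le, show i + 1 ≤ k by omega] using hadj i (by omega)
    · intro i hi
      obtain rfl | h1 : i + 1 = k ∨ i + 1 < k := by omega
      · simpa using hopen
      · have h2 := hcol (i + 1) (by omega) (by omega)
        have : H.TripleOpen Z (f i) (f (i + 1)) (f (i + 2)) :=
          .inl ⟨h2.1, h2.2.1, mem_ancSet_of_mem (hZ (i + 1) (by omega) h1)⟩
        simpa [show i ≤ k by omega, show i + 1 ≤ k by omega, show i + 2 ≤ k by omega] using this
  have hZ : ∀ k, 0 < k → k < n - 1 → f k ∈ Z := by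
    intro k
    induction k using Nat.strong_induction_on with
    | _ k ih =>
    intro hk hkn
    by_contra hkZ
    have h1 := hcol k hk hkn
    have h2 := hH.directed_iff.1 h1.2.2
    exact key k hk (by omega) (fun i hi hik => ih i hik hi (by omega)) h2.1
      (.inr ⟨hkZ, .inr (.inr ⟨h1.1, h2.2.1, h2.2.2⟩)⟩)
  obtain ⟨m, rfl⟩ : ∃ m, n = m + 2 := ⟨n - 2, by omega⟩
  have hm := key (m + 1) (by omega) (by omega) (fun i hi him => hZ i hi (by omega))
    (hadj (m + 1) (by omega))
  have hc : 0 < m → ¬ H.Ant (f m) (f (m + 1)) ∧ H.Ant (f m) (f (m + 2)) := fun h =>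
    have := hcol m h (by omega)
    ⟨this.2.1, (hH.directed_iff.1 this.2.2).2.1⟩
  have a0 := hadj m (by omega)
  have a1 := hadj (m + 1) (by omega)
  have hm0 : ¬ 0 < m → ¬ H.Adj (f m) (f (m + 2)) := by
    intro h
    obtain rfl : m = 0 := by omega
    exact hnadj
  simp only [Nat.add_sub_cancel, show m + 2 - 1 = m + 1 by omega] at hm ⊢
  constructor
  · rintro hz ⟨h1, h2⟩
    exact hm (.inl ⟨h1, h2, mem_ancSet_of_mem hz⟩)
  · intro hnc
    by_contra hz
    refine hm (.inr ⟨hz, ?_⟩)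
    by_cases h1 : H.Ant (f (m + 1)) (f m)
    · by_cases h2 : H.Ant (f (m + 1)) (f (m + 2))
      · exact .inl ⟨h1, h2⟩
      -- An arrowhead meeting an undirected edge is ruled out: for `0 < m` because `f m` is a
      -- collider, for `m = 0` because σ-completeness would join the ends.
      · refine .inr (.inl ⟨h1, h2, fun h3 => ?_⟩)
        by_cases h0 : 0 < m
        · exact (hc h0).1 h3
        · exact hm0 h0 (hH.adj_of_into a1.symm h2 a0.symm h1 h3).symm
    · have h2 : H.Ant (f (m + 1)) (f (m + 2)) := by tauto
      refine .inr (.inr ⟨h1, h2, fun h3 => ?_⟩)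
      by_cases h0 : 0 < m
      · exact (hc h0).1 ((hc h0).2.trans h3)
      · exact hm0 h0 (hH.adj_of_into a0 h1 a1 h2 h3)

theorem IsSigmaMAG.not_mSeparated_of_adj (hH : H.IsSigmaMAG) {a c : V} (h : H.Adj a c) {Z : Set V}
    (ha : a ∉ Z) (hc : c ∉ Z) : ¬ H.MSeparated {a} {c} Z := by
  intro hsep
  have := hH.mSeparated_iff.1 hsep 1 (fun k => if k = 0 then a else c)
    ⟨fun k hk => by obtain rfl : k = 0 := by omega
                    simpa using h, fun k hk => by omega⟩ (by simp) (by simp) (by simpa using ha)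
  exact hc (by simpa using this)

/-! ### Necessity of the three conditions. -/

section MarkovEquivalence

variable {H₁ H₂ : MixedGraph V}

theorem MMarkovEquivalent.symm (h : H₁.MMarkovEquivalent H₂) : H₂.MMarkovEquivalent H₁ :=
  fun X Y Z => (h X Y Z).symm

theorem MMarkovEquivalent.adj (h₁ : H₁.IsSigmaMAG) (h₂ : H₂.IsSigmaMAG)
    (h : H₁.MMarkovEquivalent H₂) {a b : V} (hab : H₁.Adj a b) : H₂.Adj a b := by
  by_contra hn
  obtain ⟨Z, ha, hb, hsep⟩ := h₂.exists_mSeparated (h₁.ne_of_adj hab) hn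
  exact h₁.not_mSeparated_of_adj hab ha hb ((h _ _ _).2 hsep)

theorem MMarkovEquivalent.sameAdjacencies (h₁ : H₁.IsSigmaMAG) (h₂ : H₂.IsSigmaMAG)
    (h : H₁.MMarkovEquivalent H₂) : H₁.SameAdjacencies H₂ :=
  fun _ _ => ⟨h.adj h₁ h₂, h.symm.adj h₂ h₁⟩

theorem MMarkovEquivalent.isUnshieldedCollider (h₁ : H₁.IsSigmaMAG) (h₂ : H₂.IsSigmaMAG)
    (h : H₁.MMarkovEquivalent H₂) {a b c : V} (habc : H₁.IsUnshieldedCollider a b c) :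
    H₂.IsUnshieldedCollider a b c := by
  obtain ⟨⟨hab, hbc, hac, h1, h2, h3⟩, h4, h5⟩ := habc
  have hadj := h.sameAdjacencies h₁ h₂
  obtain ⟨Z, ha, hc, hsep⟩ := h₁.exists_mSeparated hac h3
  let f : ℕ → V := fun k => if k = 0 then a else if k = 1 then b else c
  have hf1 : ∀ k, k < 2 → H₁.Adj (f k) (f (k + 1)) := by
    intro k hk
    interval_cases k
    · exact h1.symm
    · exact h2
  have e1 := h₁.mem_iff_of_mSeparated (n := 2) (f := f) le_rfl hf1 h3 ha hc hsep
    (fun k hk hk' => by omega)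
  have e2 := h₂.mem_iff_of_mSeparated (n := 2) (f := f) le_rfl (fun k hk => (hadj _ _).1 (hf1 k hk))
    (fun h' => h3 ((hadj _ _).2 h')) ha hc ((h _ _ _).1 hsep) (fun k hk hk' => by omega)
  rw [e1, not_iff_not] at e2
  have h6 := e2.1 ⟨(h₁.into_iff.1 h4).2, (h₁.into_iff.1 h5).2⟩
  have a1 := (hadj _ _).1 h1
  have a2 := (hadj _ _).1 h2
  exact ⟨⟨hab, hbc, hac, a1, a2, fun h' => h3 ((hadj _ _).2 h')⟩,
    h₂.into_iff.2 ⟨a1.symm, h6.1⟩, h₂.into_iff.2 ⟨a2.symm, h6.2⟩⟩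

theorem Walk.IsDiscriminating.mem_iff (hH : H.IsSigmaMAG) {π : H.Walk} (hπ : π.IsDiscriminating)
    {Z : Set V} (h0 : π.start ∉ Z) (hn : π.finish ∉ Z)
    (hsep : H.MSeparated {π.start} {π.finish} Z) :
    π.node (π.len - 1) ∈ Z ↔ ¬ π.IsCollider (π.len - 1) := by
  obtain ⟨hlen, -, hnadj, hcol⟩ := hπ
  rw [hH.isCollider_iff π (by omega) (by omega),
    hH.mem_iff_of_mSeparated (by omega) (fun k hk => ⟨_, _, π.isEdge k hk⟩) hnadj h0 hn hsep,
    show π.len - 1 + 1 = π.len by omega, show π.len - 1 - 1 = π.len - 2 by omega]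
  intro k hk hkn
  have h1 := hcol k hk hkn
  rw [hH.isCollider_iff π hk (by omega)] at h1
  exact ⟨h1.1.1, h1.1.2, h1.2⟩

theorem MMarkovEquivalent.sameDiscriminatedColliders (h₁ : H₁.IsSigmaMAG) (h₂ : H₂.IsSigmaMAG)
    (h : H₁.MMarkovEquivalent H₂) : H₁.SameDiscriminatedColliders H₂ := by
  intro π₁ π₂ hc hd₁ hd₂
  have hs : π₁.start = π₂.start := hc.2 0 (by omega)
  have hf : π₁.finish = π₂.finish := by
    rw [Walk.finish, Walk.finish, ← hc.1]
    exact hc.2 _ le_rfl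
  have hb : π₁.node (π₁.len - 1) = π₂.node (π₂.len - 1) := by
    rw [← hc.1]
    exact hc.2 _ (by omega)
  have hne : π₁.start ≠ π₁.finish := fun e => by
    have := hd₁.2.1 0 π₁.len (by omega) le_rfl e
    have := hd₁.1
    omega
  obtain ⟨Z, ha, hc, hsep⟩ := h₁.exists_mSeparated hne hd₁.2.2.1
  have e1 := hd₁.mem_iff h₁ ha hc hsep
  have hsep2 := (h _ _ _).1 hsep
  rw [hs] at ha hsep2
  rw [hf] at hc hsep2
  have e2 := hd₂.mem_iff h₂ ha hc hsep2
  rw [hb, e2] at e1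
  exact (not_iff_not.1 e1).symm

end MarkovEquivalence

/-! ### Shortest open walks. -/

section TripleOpen

variable {Z : Set V} {u u' v w w' : V}

theorem TripleOpen.congr_left (h : H.TripleOpen Z u v w) (h1 : H.Ant u u') (h2 : H.Ant u' u) :
    H.TripleOpen Z u' v w := by
  have e1 : H.Ant v u ↔ H.Ant v u' := ⟨fun h => h.trans h1, fun h => h.trans h2⟩
  have e2 : H.Ant u v ↔ H.Ant u' v := ⟨h2.trans, h1.trans⟩
  simpa only [TripleOpen, e1, e2] using h

theorem TripleOpen.congr_right (h : H.TripleOpen Z u v w) (h1 : H.Ant w w') (h2 : H.Ant w' w) :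
    H.TripleOpen Z u v w' := (h.symm.congr_left h1 h2).symm

/-- When the mark at `v` on the first edge is an arrowhead, openness does not depend on the other
end of that edge. -/
theorem TripleOpen.of_into (h : H.TripleOpen Z u v w) (h1 : ¬ H.Ant v u) (h2 : ¬ H.Ant v u') :
    H.TripleOpen Z u' v w := by
  simp only [TripleOpen, h1, h2] at *
  tauto

end TripleOpen

/-- The second alternative in `hr` can fail to be open only through an arrowhead meeting an
undirected edge. Then the edge from `t` is copied at the next node, and the attempt is repeated
there. -/
theorem OpenSeq.exists_slide (hH : H.IsSigmaMAG) {Z : Set V} {n : ℕ} {f : ℕ → V}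
    (h : H.OpenSeq Z n f) {t : V} {y : ℕ} (hy : y ≤ n) (hadj : H.Adj t (f y))
    (hr : y < n → H.TripleOpen Z t (f y) (f (y + 1)) ∨
      ¬ H.Ant (f y) t ∧ H.Ant (f y) (f (y + 1)) ∧ f y ∉ Z) :
    ∃ y', y ≤ y' ∧ y' ≤ n ∧ H.Adj t (f y') ∧ H.Ant (f y) (f y') ∧ H.Ant (f y') (f y) ∧
      (y' < n → H.TripleOpen Z t (f y') (f (y' + 1))) := by
  obtain ⟨m, rfl⟩ : ∃ m, n = y + m := ⟨n - y, by omega⟩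
  induction m generalizing y with
  | zero => exact ⟨y, le_rfl, by omega, hadj, .refl _, .refl _, by omega⟩
  | succ m ih =>
    rcases hr (by omega) with hr | ⟨h1, h2, h3⟩
    · exact ⟨y, le_rfl, by omega, hadj, .refl _, .refl _, fun _ => hr⟩
    by_cases h4 : H.Ant (f (y + 1)) (f y)
    · obtain ⟨y', hy', hyn, h5, h6, h7, h8⟩ := ih (y := y + 1) (hH.adj_congr hadj h1 h2 h4)
        (by rwa [show y + 1 + m = y + (m + 1) by omega]) (by omega) (fun hlt => by
          refine .inr ⟨fun h' => h1 (h2.trans h'), ?_⟩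
          rcases h.2 y (by omega) with h5 | ⟨h5, h6 | h6 | h6⟩
          · exact absurd h4 h5.1
          · exact ⟨h6.2, h5⟩
          · exact absurd h2 h6.2.2
          · exact absurd h4 h6.1)
      exact ⟨y', by omega, by omega, h5, h2.trans h6, h7.trans h4, fun h => h8 (by omega)⟩
    · exact ⟨y, le_rfl, by omega, hadj, .refl _, .refl _, fun _ => .inr ⟨h3, .inr (.inr ⟨h1, h2, h4⟩)⟩⟩

/-- `f` is a shortest open walk between its endpoints. -/
def IsShortest (H : MixedGraph V) (Z : Set V) (n : ℕ) (f : ℕ → V) : Prop :=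
  H.OpenSeq Z n f ∧ ∀ m g, H.OpenSeq Z m g → g 0 = f 0 → g m = f n → n ≤ m

namespace IsShortest

variable {Z : Set V} {n : ℕ} {f : ℕ → V}

theorem reverse (h : H.IsShortest Z n f) : H.IsShortest Z n (fun k => f (n - k)) := by
  refine ⟨h.1.reverse, fun m g hg h0 hm => h.2 m _ hg.reverse ?_ ?_⟩
  · simpa using hm
  · simpa using h0

/-- Both ends of the chord slide outwards along undirected edges until the joints are open. Each
stays in its class of mutually anterior nodes, so openness of the other joint is not affected. -/
theorem not_shortcut (hH : H.IsSigmaMAG) (h : H.IsShortest Z n f) {x y : ℕ} (hxy : x + 1 < y)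
    (hyn : y ≤ n) (hadj : H.Adj (f x) (f y))
    (hl : 0 < x → H.TripleOpen Z (f (x - 1)) (f x) (f y) ∨
      ¬ H.Ant (f x) (f y) ∧ H.Ant (f x) (f (x - 1)) ∧ f x ∉ Z)
    (hr : y < n → H.TripleOpen Z (f x) (f y) (f (y + 1)) ∨
      ¬ H.Ant (f y) (f x) ∧ H.Ant (f y) (f (y + 1)) ∧ f y ∉ Z) : False := by
  obtain ⟨y', hy', hyn', h1, h2, h3, h4⟩ := h.1.exists_slide hH hyn hadj hr
  obtain ⟨x'', hx', hxn', h5, h6, h7, h8⟩ := h.1.reverse.exists_slide hH (t := f y') (y := n - x)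
    (by omega) (by simpa [show n - (n - x) = x by omega] using h1.symm) (fun hx => by
      simp only [show n - (n - x) = x by omega, show n - (n - x + 1) = x - 1 by omega]
      refine (hl (by omega)).imp (fun h => (h.congr_right h2 h3).symm) (fun h => ?_)
      exact ⟨fun h' => h.1 (h'.trans h3), h.2⟩)
  obtain ⟨x', hx'n, rfl⟩ : ∃ x', x' ≤ n ∧ x'' = n - x' := ⟨n - x'', by omega, by omega⟩
  rw [show n - (n - x') = x' by omega] at h5 h6 h7 h8
  rw [show n - (n - x) = x by omega] at h6 h7
  rw [show n - (n - x' + 1) = x' - 1 by omega] at h8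
  have hg := (h.1.take (m := x') (by omega)).glue (h.1.drop y') (by simpa using h5.symm)
    (fun hx => by simpa using (h8 (by omega)).symm)
    (fun hy => by simpa using (h4 (by omega)).congr_left h6 h7)
  have := h.2 _ _ hg (by simp) (by
    simp [show ¬ x' + 1 + (n - y') ≤ x' by omega, show y' + (n - y') = n by omega])
  omega

end IsShortest

/-- The first collider after `f k` would make `f k` an ancestor of `Z`, so the walk goes on along
directed edges. -/
theorem OpenSeq.directed_of_directed {Z : Set V} {n : ℕ} {f : ℕ → V} (hH : H.IsSigmaMAG)
    (h : H.OpenSeq Z n f) {k : ℕ} (hk : H.Ant (f k) (f (k + 1)) ∧ ¬ H.Ant (f (k + 1)) (f k))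
    (hkn : k < n) (hkZ : f k ∉ H.AncSet Z) {m : ℕ} (hkm : k < m) (hmn : m ≤ n) :
    ¬ H.Ant (f m) (f (m - 1)) := by
  suffices (f m ∈ H.AncSet Z → f k ∈ H.AncSet Z) ∧ ¬ H.Ant (f m) (f (m - 1)) from this.2
  induction m, hkm using Nat.le_induction with
  | base => exact ⟨mem_ancSet_of_directed (hH.directed_iff.2 ⟨h.1 k hkn, hk⟩), hk.2⟩
  | succ m hm ih =>
    obtain ⟨h1, h2⟩ := ih (by omega)
    rcases h.triple (k := m) (by omega) (by omega) with h3 | ⟨-, h3 | h3 | h3⟩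
    · exact absurd (h1 h3.2.2) hkZ
    · exact absurd h3.1 h2
    · exact absurd h3.1 h2
    · exact ⟨fun h' => h1 (mem_ancSet_of_directed
        (hH.directed_iff.2 ⟨h.1 m (by omega), h3.2⟩) h'), h3.2.2⟩

namespace IsShortest

variable {Z : Set V} {n : ℕ} {f : ℕ → V}

/-- Cutting out the loop could only fail if the joint became a collider outside `H.AncSet Z`. The
walk would then leave `f x` by a directed edge and, by `directed_of_directed`, re-enter at `y` with
an arrowhead, making `y` a collider already. -/
theorem ne_of_lt (hH : H.IsSigmaMAG) (h : H.IsShortest Z n f) {x y : ℕ} (hxy : x < y)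
    (hyn : y ≤ n) : f x ≠ f y := by
  intro e
  rcases Nat.eq_zero_or_pos x with rfl | hx
  · have := h.2 _ _ (h.1.drop y) (by simpa using e.symm)
      (by simp [show y + (n - y) = n by omega])
    omega
  obtain rfl | hyn := hyn.eq_or_lt
  · have := h.2 _ _ (h.1.take hxy.le) rfl e
    omega
  have a1 := h.1.adj hx (by omega)
  have a2 := h.1.1 y hyn
  have t1 := h.1.triple hx (by omega)
  have t2 := h.1.triple (by omega) hyn
  have c1 : ¬ (H.TripleOpen Z (f (x - 1)) (f y) (f (y + 1)) ∨
      ¬ H.Ant (f y) (f (x - 1)) ∧ H.Ant (f y) (f (y + 1)) ∧ f y ∉ Z) := fun hr => by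
    refine h.not_shortcut hH (x := x - 1) (y := y) (by omega) hyn.le (by rwa [← e])
      (fun hx1 => .inl ?_) (fun _ => hr)
    have := h.1.triple (k := x - 1) hx1 (by omega)
    rwa [show x - 1 + 1 = x by omega, e] at this
  have c2 : ¬ (H.TripleOpen Z (f (x - 1)) (f x) (f (y + 1)) ∨
      ¬ H.Ant (f x) (f (y + 1)) ∧ H.Ant (f x) (f (x - 1)) ∧ f x ∉ Z) := fun hl => by
    refine h.not_shortcut hH (x := x) (y := y + 1) (by omega) (by omega) (by rwa [e])
      (fun _ => hl) (fun hy1 => .inl ?_)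
    have := h.1.2 y (by omega)
    rwa [← e] at this
  have hd : H.Ant (f x) (f (x + 1)) ∧ ¬ H.Ant (f (x + 1)) (f x) → f x ∉ H.AncSet Z →
      ¬ H.Ant (f y) (f (y - 1)) := fun h1 h2 =>
    h.1.directed_of_directed hH h1 (by omega) h2 hxy hyn.le
  rw [e] at c2 hd t1
  clear h a1 a2
  by_cases p : H.Ant (f y) (f (x - 1)) <;> by_cases q : H.Ant (f y) (f (y + 1)) <;>
    simp only [TripleOpen, p, q, not_true_eq_false, not_false_eq_true, true_and, false_and,
      and_true, and_false, or_false, false_or, not_or] at c1 c2 t1 t2 <;> grind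

/-- The edge from `f (i - 2)` into `f (i - 1)` would be copied at `f (i + 1)`, giving a shortcut. -/
theorem not_into_undirected (hH : H.IsSigmaMAG) (h : H.IsShortest Z n f) {i : ℕ} (hi : 1 < i)
    (hin : i < n) (h1 : ¬ H.Ant (f (i - 1)) (f (i - 2))) (h2 : H.Ant (f (i - 1)) (f (i + 1)))
    (h3 : H.Ant (f (i + 1)) (f (i - 1))) : False := by
  obtain ⟨i, rfl⟩ : ∃ j, i = j + 2 := ⟨i - 2, by omega⟩
  simp only [Nat.add_sub_cancel, show i + 2 - 1 = i + 1 by omega] at h1 h2 h3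
  have t1 := h.1.2 i (by omega)
  have t2 := h.1.2 (i + 1) (by omega)
  refine h.not_shortcut hH (x := i) (y := i + 2 + 1) (by omega) (by omega)
    (hH.adj_congr (h.1.1 i (by omega)) h1 h2 h3) (fun hi => .inl ?_) (fun hi => ?_)
  · exact (h.1.triple hi (by omega)).congr_right h2 h3
  · have t3 := h.1.2 (i + 2) (by omega)
    have hA : H.Ant (f (i + 3)) (f (i + 2)) → ¬ H.Ant (f (i + 2)) (f (i + 3)) →
        f (i + 2) ∈ H.AncSet Z → f (i + 3) ∈ H.AncSet Z := fun h4 h5 =>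
      mem_ancSet_of_directed (hH.directed_iff.2 ⟨(h.1.1 (i + 2) (by omega)).symm, h4, h5⟩)
    have e1 : H.Ant (f (i + 2)) (f (i + 3)) ↔ H.Ant (f (i + 2)) (f (i + 1)) :=
      ⟨fun h' => h'.trans h3, fun h' => h'.trans h2⟩
    have e2 : H.Ant (f (i + 3)) (f (i + 2)) ↔ H.Ant (f (i + 1)) (f (i + 2)) :=
      ⟨h2.trans, h3.trans⟩
    have e3 : ¬ H.Ant (f (i + 3)) (f i) := fun h' => h1 (h2.trans h')
    simp only [TripleOpen, add_assoc, Nat.reduceAdd, e1, e2, e3] at *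
    tauto

/-- Skipping `f i` must fail at one of its neighbours. A non-collider that turns into a collider
causes no failure, since it is then an ancestor of `Z`; what remains is a collider that turns into a
non-collider. -/
theorem shielded (hH : H.IsSigmaMAG) (h : H.IsShortest Z n f) {i : ℕ} (hi : 0 < i) (hin : i < n)
    (hadj : H.Adj (f (i - 1)) (f (i + 1))) :
    (1 < i ∧ ¬ H.Ant (f (i - 1)) (f (i - 2)) ∧ ¬ H.Ant (f (i - 1)) (f i) ∧
      H.Directed (f (i - 1)) (f (i + 1))) ∨
    (i + 1 < n ∧ ¬ H.Ant (f (i + 1)) (f (i + 2)) ∧ ¬ H.Ant (f (i + 1)) (f i) ∧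
      H.Directed (f (i + 1)) (f (i - 1))) := by
  obtain ⟨i, rfl⟩ : ∃ j, i = j + 1 := ⟨i - 1, by omega⟩
  by_contra hcon
  simp only [Nat.add_sub_cancel, add_assoc, Nat.reduceAdd] at hadj
  simp only [hH.directed_iff, Nat.add_sub_cancel, add_assoc, Nat.reduceAdd, hadj,
    hadj.symm, true_and, not_or] at hcon
  obtain ⟨hc1, hc2⟩ := hcon
  have t2 := h.1.2 i (by omega)
  refine h.not_shortcut hH (x := i) (y := i + 2) (by omega) (by omega) hadj
    (fun hi => ?_) (fun hi => ?_)
  · have t1 := h.1.triple hi (by omega)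
    have n1 := h.not_into_undirected hH (i := i + 1) (by omega) hin
    have hA : H.Ant (f i) (f (i + 1)) → ¬ H.Ant (f (i + 1)) (f i) →
        f (i + 1) ∈ H.AncSet Z → f i ∈ H.AncSet Z := fun h4 h5 =>
      mem_ancSet_of_directed (hH.directed_iff.2 ⟨h.1.1 i (by omega), h4, h5⟩)
    have e1 : H.Ant (f i) (f (i + 1)) → H.Ant (f (i + 1)) (f (i + 2)) → H.Ant (f i) (f (i + 2)) :=
      .trans
    simp only [Nat.add_sub_cancel, add_assoc, Nat.reduceAdd, show i + 1 - 2 = i - 1 by omega,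
      show 1 < i + 1 by omega, true_and] at n1 hc1
    clear hc2
    unfold TripleOpen at *
    grind
  · have t3 := h.1.2 (i + 1) (by omega)
    have n1 := h.reverse.not_into_undirected hH (i := n - (i + 1)) (by omega) (by omega)
    simp only [show n - (n - (i + 1) - 1) = i + 2 by omega, show n - (n - (i + 1) - 2) = i + 3 by omega,
      show n - (n - (i + 1) + 1) = i by omega] at n1
    have hA : H.Ant (f (i + 2)) (f (i + 1)) → ¬ H.Ant (f (i + 1)) (f (i + 2)) →
        f (i + 1) ∈ H.AncSet Z → f (i + 2) ∈ H.AncSet Z := fun h4 h5 =>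
      mem_ancSet_of_directed (hH.directed_iff.2 ⟨(h.1.1 (i + 1) (by omega)).symm, h4, h5⟩)
    have e1 : H.Ant (f (i + 2)) (f (i + 1)) → H.Ant (f (i + 1)) (f i) → H.Ant (f (i + 2)) (f i) :=
      .trans
    simp only [add_assoc, Nat.reduceAdd, hi, true_and] at hc2 t3 ⊢
    clear hc1
    unfold TripleOpen at *
    grind

end IsShortest

/-! ### Discriminating paths inside shortest open walks. -/

/-- The nodes strictly between `f x` and `f y` are colliders and parents of `w`. -/
def ParentColliders (H : MixedGraph V) (f : ℕ → V) (x y : ℕ) (w : V) : Prop :=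
  ∀ k, x < k → k < y →
    ¬ H.Ant (f k) (f (k - 1)) ∧ ¬ H.Ant (f k) (f (k + 1)) ∧ H.Directed (f k) w

/-- If `f (j - 1) *→ f j` and `f j` is anterior to `w`, then going back from `f j` along colliders
that are parents of `w` leads to a node that is not adjacent to `w` or that can be joined to `w`. -/
theorem OpenSeq.exists_parentColliders (hH : H.IsSigmaMAG) {Z : Set V} {n : ℕ} {f : ℕ → V}
    (h : H.OpenSeq Z n f) {w : V} {j : ℕ} (hj : 0 < j) (hjn : j ≤ n)
    (h1 : ¬ H.Ant (f j) (f (j - 1))) (h2 : H.Ant (f j) w) :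
    ∃ x, x < j ∧ H.ParentColliders f x j w ∧ (¬ H.Adj (f x) w ∨
      H.Adj (f x) w ∧ ¬ H.Ant w (f x) ∧ (0 < x → H.TripleOpen Z (f (x - 1)) (f x) w)) := by
  induction j with
  | zero => omega
  | succ j ih =>
    simp only [Nat.add_sub_cancel] at h1
    by_cases hadj : H.Adj (f j) w
    · have h3 : ¬ H.Ant w (f j) := fun h' => h1 (h2.trans h')
      by_cases hj0 : 0 < j → H.TripleOpen Z (f (j - 1)) (f j) w
      · exact ⟨j, by omega, fun k _ _ => by omega, .inr ⟨hadj, h3, hj0⟩⟩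
      · push Not at hj0
        obtain ⟨hj0, h4⟩ := hj0
        -- If the joint at `f j` is not open, then `f j` is a collider on the walk and a parent of
        -- `w`, so the search continues from `f j`.
        have h5 := h.triple hj0 (by omega)
        have h6 : H.Ant (f j) (f (j + 1)) → H.Ant (f j) w := fun h' => h'.trans h2
        have h7 : ¬ H.Ant (f j) (f (j - 1)) ∧ ¬ H.Ant (f j) (f (j + 1)) ∧ H.Ant (f j) w := by
          clear ih
          unfold TripleOpen at *
          tauto
        obtain ⟨x, hx, h8, h9⟩ := ih hj0 (by omega) h7.1 h7.2.2
        refine ⟨x, by omega, fun k hk hkj => ?_, h9⟩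
        obtain rfl | hkj : k = j ∨ k < j := by omega
        · exact ⟨h7.1, h7.2.1, hH.directed_iff.2 ⟨hadj, h7.2.2, h3⟩⟩
        · exact h8 k hk hkj
    · exact ⟨j, by omega, fun k _ _ => by omega, .inl hadj⟩

/-- `(f x, …, f i, f (i + 1))` is a discriminating path for `f i`. -/
def DiscriminatedLeft (H : MixedGraph V) (f : ℕ → V) (x i : ℕ) : Prop :=
  x + 1 < i ∧ ¬ H.Adj (f x) (f (i + 1)) ∧ H.ParentColliders f x i (f (i + 1))

/-- `(f y, …, f i, f (i - 1))` is a discriminating path for `f i`. -/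
def DiscriminatedRight (H : MixedGraph V) (f : ℕ → V) (i y : ℕ) : Prop :=
  i + 1 < y ∧ ¬ H.Adj (f y) (f (i - 1)) ∧ H.ParentColliders f i y (f (i - 1))

theorem DiscriminatedLeft.of_reverse {n : ℕ} {f : ℕ → V} {x i : ℕ} (hi : 0 < i) (hin : i < n)
    (h : H.DiscriminatedLeft (fun k => f (n - k)) x (n - i)) :
    H.DiscriminatedRight f i (n - x) := by
  obtain ⟨h1, h2, h3⟩ := h
  simp only [show n - (n - i + 1) = i - 1 by omega] at h2 h3
  refine ⟨by omega, h2, fun k hk hkx => ?_⟩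
  have := h3 (n - k) (by omega) (by omega)
  simp only [show n - (n - k) = k by omega, show n - (n - k - 1) = k + 1 by omega,
    show n - (n - k + 1) = k - 1 by omega] at this
  exact ⟨this.2.1, this.1, this.2.2⟩

namespace IsShortest

variable {Z : Set V} {n : ℕ} {f : ℕ → V}

/-- The backward search for `f (i + 1)` must end at a non-adjacent node, because the other outcome
is a shortcut to `f (i + 1)`. -/
theorem exists_discriminatedLeft (hH : H.IsSigmaMAG) (h : H.IsShortest Z n f) {i : ℕ}
    (hi : 1 < i) (hin : i < n) (h1 : ¬ H.Ant (f (i - 1)) (f (i - 2)))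
    (h2 : ¬ H.Ant (f (i - 1)) (f i)) (h3 : H.Directed (f (i - 1)) (f (i + 1))) :
    ∃ x, H.DiscriminatedLeft f x i := by
  have h4 := hH.directed_iff.1 h3
  obtain ⟨x, hx, hx1, hx2⟩ := h.1.exists_parentColliders hH (j := i - 1) (w := f (i + 1))
    (by omega) (by omega) (by rwa [show i - 1 - 1 = i - 2 by omega]) h4.2.1
  refine ⟨x, by omega, ?_, fun k hk hki => ?_⟩
  · rcases hx2 with hx2 | ⟨hx2, hx3, hx4⟩
    · exact hx2
    · exact (h.not_shortcut hH (x := x) (y := i + 1) (by omega) (by omega) hx2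
        (fun hx0 => .inl (hx4 hx0)) (fun hi1 => .inl
          ((h.1.2 i hi1).of_into (fun h' => h2 (h4.2.1.trans h')) hx3))).elim
  · obtain rfl | hki : k = i - 1 ∨ k < i - 1 := by omega
    · rw [show i - 1 - 1 = i - 2 by omega, show i - 1 + 1 = i by omega]
      exact ⟨h1, h2, h3⟩
    · exact hx1 k hk hki

/-- On a shortest open walk, every shielded position is discriminated. -/
theorem discriminated (hH : H.IsSigmaMAG) (h : H.IsShortest Z n f) {i : ℕ} (hi : 0 < i)
    (hin : i < n) (hadj : H.Adj (f (i - 1)) (f (i + 1))) :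
    (∃ x, H.DiscriminatedLeft f x i) ∨ ∃ y, y ≤ n ∧ H.DiscriminatedRight f i y := by
  rcases h.shielded hH hi hin hadj with ⟨h1, h2, h3, h4⟩ | ⟨h1, h2, h3, h4⟩
  · exact .inl (h.exists_discriminatedLeft hH h1 hin h2 h3 h4)
  · obtain ⟨x, hx⟩ := h.reverse.exists_discriminatedLeft hH (i := n - i) (by omega) (by omega)
      (by simpa only [show n - (n - i - 1) = i + 1 by omega, show n - (n - i - 2) = i + 2 by omega])
      (by simpa only [show n - (n - i - 1) = i + 1 by omega, show n - (n - i) = i by omega])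
      (by simpa only [show n - (n - i - 1) = i + 1 by omega, show n - (n - i + 1) = i - 1 by omega])
    exact .inr ⟨n - x, by omega, hx.of_reverse hi hin⟩

/-- Positions `j` to `i` are colliders anterior to `f (j - 1)` or `f (i + 1)`. So
`ColliderSeq.adj_ends` would join these two nodes, which cannot be adjacent. -/
theorem not_discriminated_cycle (hH : H.IsSigmaMAG) (h : H.IsShortest Z n f) {x j i y : ℕ}
    (hl : H.DiscriminatedLeft f x i) (hr : H.DiscriminatedRight f j y) (hxj : x < j) (hji : j < i)
    (hiy : i < y) (hyn : y ≤ n) : False := by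
  obtain ⟨-, l1, l2⟩ := hl
  obtain ⟨-, r1, r2⟩ := hr
  have hjj := l2 j hxj hji
  have hii := r2 i hji hiy
  have hnadj : ¬ H.Adj (f (j - 1)) (f (i + 1)) := by
    intro hadj
    obtain hx | hx : x = j - 1 ∨ x < j - 1 := by omega
    · exact l1 (by rwa [hx])
    obtain hy | hy : y = i + 1 ∨ i + 1 < y := by omega
    · exact r1 (by rw [hy]; exact hadj.symm)
    -- Here `f (j - 1)` and `f (i + 1)` would be parents of each other.
    exact (hH.directed_iff.1 (l2 (j - 1) hx (by omega)).2.2).2.2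
      (hH.directed_iff.1 (r2 (i + 1) (by omega) hy).2.2).2.1
  have hcol : ∀ k, j ≤ k → k ≤ i → ¬ H.Ant (f k) (f (k - 1)) ∧ ¬ H.Ant (f k) (f (k + 1)) ∧
      (H.Ant (f k) (f (j - 1)) ∨ H.Ant (f k) (f (i + 1))) := by
    intro k hjk hki
    obtain rfl | hki := hki.eq_or_lt
    · exact ⟨hii.1, hii.2.1, .inl (hH.directed_iff.1 hii.2.2).2.1⟩
    · have := l2 k (by omega) hki
      exact ⟨this.1, this.2.1, .inr (hH.directed_iff.1 this.2.2).2.1⟩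
  refine hnadj (ColliderSeq.adj_ends (n := i + 2 - j) (f := fun k => f (j - 1 + k)) hH
    (h.ne_of_lt hH (by omega) (by omega)) ⟨by simp, ?_, ?_, ?_, ?_, ?_⟩)
  · simp [show j - 1 + (i + 2 - j) = i + 1 by omega]
  · exact fun k hk => h.1.1 (j - 1 + k) (by omega)
  · intro k hk
    have := (hcol (j - 1 + k + 1) (by omega) (by omega)).1
    simpa [add_assoc] using this
  · exact fun k hk hkn => (hcol (j - 1 + k) (by omega) (by omega)).2.1
  · exact fun k hk hkn => (hcol (j - 1 + k) (by omega) (by omega)).2.2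

end IsShortest

variable {H₁ H₂ : MixedGraph V}

/-- The discriminating path `(f x, …, f i, w)` for `f i`. -/
theorem ParentColliders.exists_isDiscriminating (hH : H.IsSigmaMAG) {f : ℕ → V} {x i : ℕ} {w : V}
    (hxi : x + 1 < i) (hadj : ∀ k, x ≤ k → k < i → H.Adj (f k) (f (k + 1))) (hiw : H.Adj (f i) w)
    (hinj : ∀ j k, x ≤ j → j < k → k ≤ i → f j ≠ f k) (hxw : f x ≠ w) (hnadj : ¬ H.Adj (f x) w)
    (hp : H.ParentColliders f x i w) :
    ∃ π : H.Walk, π.len = i + 1 - x ∧ π.node = (fun k => if k ≤ i - x then f (x + k) else w) ∧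
      π.IsDiscriminating ∧ (π.IsCollider (π.len - 1) ↔
        ¬ H.Ant (f i) (f (i - 1)) ∧ ¬ H.Ant (f i) w) := by
  have hne : ∀ k, x ≤ k → k ≤ i → f k ≠ w := by
    intro k hk hki
    obtain rfl | hk := hk.eq_or_lt
    · exact hxw
    obtain rfl | hki := hki.eq_or_lt
    · exact hH.ne_of_adj hiw
    · exact hH.ne_of_adj (hH.directed_iff.1 (hp k hk hki).2.2).1
  obtain ⟨π, hlen, hnode⟩ := hH.exists_walk (n := i + 1 - x)
    (f := fun k => if k ≤ i - x then f (x + k) else w) (fun k hk => by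
      obtain rfl | hk : k = i - x ∨ k < i - x := by omega
      · simpa [show x + (i - x) = i by omega] using hiw
      · simpa [hk.le, show k + 1 ≤ i - x by omega, add_assoc] using
          hadj (x + k) (by omega) (by omega))
  have hfin : π.finish = w := by simp [Walk.finish, hlen, hnode, show ¬ i + 1 - x ≤ i - x by omega]
  refine ⟨π, hlen, hnode, ⟨by omega, ?_, ?_, ?_⟩, ?_⟩
  · intro j k hj hk e
    rw [hlen] at hj hk
    simp only [hnode] at e
    by_cases hj' : j ≤ i - x <;> by_cases hk' : k ≤ i - x <;> simp only [hj', hk', if_true,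
      if_false] at e
    · rcases lt_trichotomy j k with h | h | h
      · exact absurd e (hinj _ _ (by omega) (by omega) (by omega))
      · exact h
      · exact absurd e.symm (hinj _ _ (by omega) (by omega) (by omega))
    · exact absurd e (hne _ (by omega) (by omega))
    · exact absurd e.symm (hne _ (by omega) (by omega))
    · omega
  · simpa [hfin, Walk.start, hnode] using hnadj
  · intro k hk hkn
    have := hp (x + k) (by omega) (by omega)
    rw [hfin, hH.isCollider_iff π hk (by omega)]
    simpa [hnode, show k ≤ i - x by omega, show k - 1 ≤ i - x by omega,
      show k + 1 ≤ i - x by omega, show x + (k - 1) = x + k - 1 by omega, ← add_assoc, and_assoc]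
      using this
  · rw [hH.isCollider_iff π (by omega) (by omega), hlen]
    simp [hnode, show i + 1 - x - 1 = i - x by omega, show x + (i - x) = i by omega,
      show i - x - 1 ≤ i - x by omega, show x + (i - x - 1) = i - 1 by omega]

/-! ### Transferring colliders to the other graph. -/

section Transfer

theorem SameAdjacencies.symm (h : H₁.SameAdjacencies H₂) : H₂.SameAdjacencies H₁ :=
  fun a b => (h a b).symm

theorem SameUnshieldedColliders.symm (h : H₁.SameUnshieldedColliders H₂) :
    H₂.SameUnshieldedColliders H₁ := fun a b c => (h a b c).symm

theorem SameDiscriminatedColliders.symm (h : H₁.SameDiscriminatedColliders H₂) :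
    H₂.SameDiscriminatedColliders H₁ := fun π₂ π₁ hc h₂ h₁ =>
  (h π₁ π₂ ⟨hc.1.symm, fun k hk => (hc.2 k (by rwa [hc.1])).symm⟩ h₁ h₂).symm

theorem SameUnshieldedColliders.collider_iff (h₁ : H₁.IsSigmaMAG) (h₂ : H₂.IsSigmaMAG)
    (hU : H₁.SameUnshieldedColliders H₂) (hA : H₁.SameAdjacencies H₂) {a b c : V}
    (hab : H₁.Adj a b) (hbc : H₁.Adj b c) (hac : a ≠ c) (hnadj : ¬ H₁.Adj a c) :
    (¬ H₁.Ant b a ∧ ¬ H₁.Ant b c) ↔ (¬ H₂.Ant b a ∧ ¬ H₂.Ant b c) := by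
  have := hU a b c
  simpa [IsUnshieldedCollider, IsUnshielded, h₁.into_iff, h₂.into_iff, ← hA _ _, hab, hab.symm, hbc,
    hbc.symm, hac, hnadj, h₁.ne_of_adj hab, h₁.ne_of_adj hbc] using this

/-- Were the edge from `v` to `w` undirected, σ-completeness would join `u` to `w`, and `huw` would
make `u` anterior to `v` after all. -/
theorem IsSigmaMAG.directed_of_not_collider (hH : H.IsSigmaMAG) {u v w : V} (huv : H.Adj u v)
    (hvu : ¬ H.Ant v u) (hvw : H.Adj v w) (hnc : ¬ (¬ H.Ant v u ∧ ¬ H.Ant v w))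
    (huw : H.Adj u w → H.Ant u w ∧ ¬ H.Ant u v) : H.Directed v w := by
  have h : H.Ant v w := by tauto
  refine hH.directed_iff.2 ⟨hvw, h, fun hwv => ?_⟩
  have := huw (hH.adj_of_into huv hvu hvw h hwv)
  exact this.2 (this.1.trans hwv)

/-- Two graphs on the same nodes that satisfy the graphical criterion. -/
structure Similar (H₁ H₂ : MixedGraph V) : Prop where
  left : H₁.IsSigmaMAG
  right : H₂.IsSigmaMAG
  adj : H₁.SameAdjacencies H₂
  unshielded : H₁.SameUnshieldedColliders H₂
  discriminated : H₁.SameDiscriminatedColliders H₂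

namespace Similar

/-- Induction along the path: each earlier node is itself discriminated by an initial piece and is
no collider there in `H₁`, hence none in `H₂`, which makes it a parent of `w`. The base case is an
unshielded triple. -/
theorem transfer (h : Similar H₁ H₂) {f : ℕ → V} {x i : ℕ} {w : V} (hxi : x < i)
    (hadj : ∀ k, x ≤ k → k < i → H₁.Adj (f k) (f (k + 1))) (hiw : H₁.Adj (f i) w)
    (hinj : ∀ j k, x ≤ j → j < k → k ≤ i → f j ≠ f k) (hxw : f x ≠ w)
    (hnadj : ¬ H₁.Adj (f x) w) (hp : H₁.ParentColliders f x i w)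
    (hc : ∀ k, x < k → k < i → ¬ H₂.Ant (f k) (f (k - 1)) ∧ ¬ H₂.Ant (f k) (f (k + 1))) :
    (¬ H₁.Ant (f i) (f (i - 1)) ∧ ¬ H₁.Ant (f i) w ↔
      ¬ H₂.Ant (f i) (f (i - 1)) ∧ ¬ H₂.Ant (f i) w) ∧
    H₂.ParentColliders f x i w := by
  induction i, hxi using Nat.le_induction with
  | base =>
    exact ⟨h.unshielded.collider_iff h.left h.right h.adj (hadj x le_rfl (by omega)) hiw hxw hnadj,
      fun k hk hk' => by omega⟩
  | succ i hxi ih =>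
    have hpi := hp i hxi (by omega)
    have hci := hc i hxi (by omega)
    have hd := h.left.directed_iff.1 hpi.2.2
    obtain ⟨ih1, ih2⟩ := ih (fun k hk hki => hadj k hk (by omega)) hd.1
      (fun j k hj hjk hk => hinj j k hj hjk (by omega)) (fun k hk hki => hp k hk (by omega))
      (fun k hk hki => hc k hk (by omega))
    have hadj' := hadj (i - 1) (by omega) (by omega)
    rw [show i - 1 + 1 = i by omega] at hadj'
    have hdi : H₂.Directed (f i) w := by
      refine h.right.directed_of_not_collider ((h.adj _ _).1 hadj') hci.1 ((h.adj _ _).1 hd.1)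
        (fun h' => (ih1.2 h').2 hd.2.1) (fun h' => ?_)
      obtain hx | hx : x = i - 1 ∨ x < i - 1 := by omega
      · exact absurd ((h.adj _ _).2 h') (by rwa [← hx])
      · have := ih2 (i - 1) hx (by omega)
        rw [show i - 1 + 1 = i by omega] at this
        exact ⟨(h.right.directed_iff.1 this.2.2).2.1, this.2.1⟩
    have hp2 : H₂.ParentColliders f x (i + 1) w := by
      intro k hk hki
      obtain rfl | hki : k = i ∨ k < i := by omega
      · exact ⟨hci.1, hci.2, hdi⟩
      · exact ih2 k hk hki
    refine ⟨?_, hp2⟩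
    obtain ⟨π₁, l1, n1, d1, c1⟩ := hp.exists_isDiscriminating h.left (by omega) hadj hiw hinj hxw
      hnadj
    obtain ⟨π₂, l2, n2, d2, c2⟩ := hp2.exists_isDiscriminating h.right (by omega)
      (fun k hk hki => (h.adj _ _).1 (hadj k hk hki)) ((h.adj _ _).1 hiw) hinj hxw
      (fun h' => hnadj ((h.adj _ _).2 h'))
    rw [← c1, ← c2]
    exact h.discriminated π₁ π₂ ⟨l1.trans l2.symm, fun k _ => by rw [n1, n2]⟩ d1 d2

variable {Z : Set V} {n : ℕ} {f : ℕ → V}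

theorem directed_of_parentColliders (h : Similar H₁ H₂) (hf : H₁.IsShortest Z n f) {x i : ℕ}
    {w : V} (hxi : x < i) (hin : i ≤ n) (hiw : H₁.Directed (f i) w)
    (hi : ¬ H₁.Ant (f i) (f (i - 1))) (hnadj : ¬ H₁.Adj (f x) w) (hp : H₁.ParentColliders f x i w)
    (hc : ∀ k, x < k → k < i → ¬ H₂.Ant (f k) (f (k - 1)) ∧ ¬ H₂.Ant (f k) (f (k + 1)))
    (hi2 : ¬ H₂.Ant (f i) (f (i - 1))) : H₂.Directed (f i) w := by
  have hd := h.left.directed_iff.1 hiw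
  have hxw : f x ≠ w := by
    rintro rfl
    obtain rfl | hxi' : i = x + 1 ∨ x + 1 < i := by omega
    · exact hi hd.2.1
    · have := hp (x + 1) (by omega) hxi'
      exact this.1 (h.left.directed_iff.1 this.2.2).2.1
  obtain ⟨h1, h2⟩ := h.transfer hxi (fun k _ hk => hf.1.1 k (by omega)) hd.1
    (fun j k _ hjk hk => hf.ne_of_lt h.left hjk (by omega)) hxw hnadj hp hc
  refine h.right.directed_of_not_collider ((h.adj _ _).1 (hf.1.adj (by omega) hin)) hi2
    ((h.adj _ _).1 hd.1) (fun h' => (h1.2 h').2 hd.2.1) (fun h' => ?_)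
  obtain hx | hx : x = i - 1 ∨ x < i - 1 := by omega
  · exact absurd ((h.adj _ _).2 h') (by rwa [← hx])
  · have := h2 (i - 1) hx (by omega)
    rw [show i - 1 + 1 = i by omega] at this
    exact ⟨(h.right.directed_iff.1 this.2.2).2.1, this.2.1⟩

/-- Position `i` is a collider in both graphs or in neither. -/
def SameAt (H₁ H₂ : MixedGraph V) (f : ℕ → V) (i : ℕ) : Prop :=
  (¬ H₁.Ant (f i) (f (i - 1)) ∧ ¬ H₁.Ant (f i) (f (i + 1))) ↔
    (¬ H₂.Ant (f i) (f (i - 1)) ∧ ¬ H₂.Ant (f i) (f (i + 1)))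

theorem sameAt_reverse {i : ℕ} (hi : 0 < i) (hin : i < n) :
    SameAt H₁ H₂ (fun k => f (n - k)) (n - i) ↔ SameAt H₁ H₂ f i := by
  simp only [SameAt, show n - (n - i) = i by omega, show n - (n - i - 1) = i + 1 by omega,
    show n - (n - i + 1) = i - 1 by omega, and_comm]

theorem discriminatedLeft (h : Similar H₁ H₂) (hf : H₁.IsShortest Z n f) {x i : ℕ} (hin : i < n)
    (hd : H₁.DiscriminatedLeft f x i) (hs : ∀ k, x < k → k < i → SameAt H₁ H₂ f k) :
    SameAt H₁ H₂ f i ∧ H₂.DiscriminatedLeft f x i := by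
  obtain ⟨hxi, hnadj, hp⟩ := hd
  obtain ⟨h1, h2⟩ := h.transfer (by omega) (fun k _ hk => hf.1.1 k (by omega)) (hf.1.1 i hin)
    (fun j k _ hjk hk => hf.ne_of_lt h.left hjk (by omega))
    (hf.ne_of_lt h.left (by omega) (by omega)) hnadj hp
    (fun k hk hki => (hs k hk hki).1 ⟨(hp k hk hki).1, (hp k hk hki).2.1⟩)
  exact ⟨h1, hxi, fun h' => hnadj ((h.adj _ _).2 h'), h2⟩

theorem discriminatedRight (h : Similar H₁ H₂) (hf : H₁.IsShortest Z n f) {i y : ℕ} (hi : 0 < i)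
    (hyn : y ≤ n) (hd : H₁.DiscriminatedRight f i y)
    (hs : ∀ k, i < k → k < y → SameAt H₁ H₂ f k) :
    SameAt H₁ H₂ f i ∧ H₂.DiscriminatedRight f i y := by
  have hiy := hd.1
  have hd' : H₁.DiscriminatedLeft (fun k => f (n - k)) (n - y) (n - i) := by
    obtain ⟨h1, h2, h3⟩ := hd
    refine ⟨by omega, ?_, fun k hk hki => ?_⟩
    · simpa only [show n - (n - y) = y by omega, show n - (n - i + 1) = i - 1 by omega]
    · have := h3 (n - k) (by omega) (by omega)
      simp only [show n - (n - i + 1) = i - 1 by omega, show n - (k - 1) = n - k + 1 by omega,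
        show n - (k + 1) = n - k - 1 by omega]
      exact ⟨this.2.1, this.1, this.2.2⟩
  obtain ⟨h1, h2⟩ := h.discriminatedLeft hf.reverse (by omega) hd' (fun k hk hki => by
    have := hs (n - k) (by omega) (by omega)
    rwa [← sameAt_reverse (n := n) (by omega) (by omega), show n - (n - k) = k by omega] at this)
  refine ⟨(sameAt_reverse (by omega) (by omega)).1 h1, ?_⟩
  have := h2.of_reverse hi (by omega)
  rwa [show n - (n - y) = y by omega] at this

/-- A position where the graphs differ must be shielded, and its discriminating path must contain
another such position. These references cannot go on forever. -/
theorem sameAt (h : Similar H₁ H₂) (hf : H₁.IsShortest Z n f) {i : ℕ} (hi : 0 < i) (hin : i < n) :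
    SameAt H₁ H₂ f i := by
  let Bad : ℕ → Prop := fun i => 0 < i ∧ i < n ∧ ¬ SameAt H₁ H₂ f i
  have key : ∀ i, Bad i → (∃ x k, H₁.DiscriminatedLeft f x i ∧ x < k ∧ k < i ∧ Bad k) ∨
      ∃ y k, y ≤ n ∧ H₁.DiscriminatedRight f i y ∧ i < k ∧ k < y ∧ Bad k := by
    rintro i ⟨hi, hin, hbad⟩
    by_cases hadj : H₁.Adj (f (i - 1)) (f (i + 1))
    · rcases hf.discriminated h.left hi hin hadj with ⟨x, hx⟩ | ⟨y, hyn, hy⟩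
      · left
        by_contra hcon
        push Not at hcon
        refine hbad (h.discriminatedLeft hf hin hx fun k hk hki => ?_).1
        by_contra hk'
        exact hcon x k hx hk hki ⟨by omega, by omega, hk'⟩
      · right
        by_contra hcon
        push Not at hcon
        refine hbad (h.discriminatedRight hf hi hyn hy fun k hk hki => ?_).1
        by_contra hk'
        exact hcon y k hyn hy hk hki ⟨by omega, by omega, hk'⟩
    · exact absurd (h.unshielded.collider_iff h.left h.right h.adj (hf.1.adj hi hin.le)
        (hf.1.1 i hin) (hf.ne_of_lt h.left (by omega) (by omega)) hadj) hbad
  -- For the last bad `j` before `i`, the induction hypothesis forces the reference from `j` to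
  -- point right.
  have noLeft : ∀ i, Bad i → ¬ ∃ x k, H₁.DiscriminatedLeft f x i ∧ x < k ∧ k < i ∧ Bad k := by
    classical
    intro i
    induction i using Nat.strong_induction_on with
    | _ i ih =>
    rintro hb ⟨x, k, hx, hxk, hki, hk⟩
    set j := Nat.findGreatest Bad (i - 1) with hj
    have hkj : k ≤ j := Nat.le_findGreatest (by omega) hk
    have hji : j ≤ i - 1 := Nat.findGreatest_le _
    have hbj : Bad j := Nat.findGreatest_spec (m := k) (by omega) hk
    rcases key j hbj with h' | ⟨y, l, hyn, hy, hjl, hly, hl⟩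
    · exact ih j (by omega) hbj h'
    -- By the choice of `j`, the bad position `l` is not before `i`. The discriminating paths at `i`
    -- and `j` then reach across each other.
    · have : i ≤ l := by
        by_contra hli
        exact Nat.findGreatest_is_greatest (hj ▸ hjl) (by omega) hl
      exact hf.not_discriminated_cycle h.left hx hy (by omega) (by omega) (by omega) hyn
  have noBad : ∀ m i, n - i = m → ¬ Bad i := by
    intro m
    induction m using Nat.strong_induction_on with
    | _ m ih =>
    intro i hm hb
    rcases key i hb with h' | ⟨y, l, hyn, hy, hjl, hly, hl⟩
    · exact noLeft i hb h'
    · exact ih (n - l) (by have := hl.2.1; omega) l rfl hl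
  by_contra hcon
  exact noBad _ i rfl ⟨hi, hin, hcon⟩

/-- An edge from `p` to `w` would yield a directed walk that `hp` forbids. So `(p, v, w)` is an
unshielded non-collider, which orients `v` towards `w` in `H₂`; this repeats along the directed
walk. -/
theorem mem_ancSet_of_reaches (h : Similar H₁ H₂) {m : ℕ} {p v : V} (hv : H₁.Reaches Z m v)
    (hp : ¬ H₁.Reaches Z m p) (hpv : H₁.Directed p v) (hpv2 : H₂.Directed p v) :
    v ∈ H₂.AncSet Z := by
  induction m generalizing p v with
  | zero => exact mem_ancSet_of_mem hv
  | succ m ih =>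
    obtain ⟨w, hvw, hw⟩ := hv
    have hd := h.left.directed_iff.1 hvw
    have hpd := h.left.directed_iff.1 hpv
    have hpd2 := h.right.directed_iff.1 hpv2
    have hpw : ¬ H₁.Adj p w := fun h' => hp ⟨w, h.left.directed_iff.2
      ⟨h', hpd.2.1.trans hd.2.1, fun h'' => hd.2.2 (h''.trans hpd.2.1)⟩, hw⟩
    have hne : p ≠ w := by
      rintro rfl
      exact hd.2.2 hpd.2.1
    have hvw2 : H₂.Directed v w := by
      refine h.right.directed_of_not_collider hpd2.1 hpd2.2.2 ((h.adj _ _).1 hd.1) (fun h' => ?_)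
        (fun h' => absurd ((h.adj _ _).2 h') hpw)
      exact ((h.unshielded.collider_iff h.left h.right h.adj hpd.1 hd.1 hne hpw).2 h').2 hd.2.1
    exact mem_ancSet_of_directed hvw2 (ih hw (fun h' => hp ⟨v, hpv, h'⟩) hvw hvw2)

end Similar

end Transfer

/-! ### Carrying ancestors and open walks over. -/

/-- The least number of edges of a directed walk from `v` to `Z`. -/
noncomputable def ancDist (H : MixedGraph V) (Z : Set V) (v : V) : ℕ := sInf {m | H.Reaches Z m v}

theorem OpenSeq.exists_detour {Z : Set V} {n : ℕ} {f : ℕ → V} (h : H.OpenSeq Z n f) {x y : ℕ}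
    {d : V} (hxn : x ≤ n) (hx : H.Adj (f x) d) (hdx : ¬ H.Ant d (f x))
    (hxo : 0 < x → H.TripleOpen Z (f (x - 1)) (f x) d) (hy : H.Adj (f y) d)
    (hdy : ¬ H.Ant d (f y)) (hyo : y < n → H.TripleOpen Z d (f y) (f (y + 1)))
    (hd : d ∈ H.AncSet Z) :
    ∃ g, H.OpenSeq Z (x + 2 + (n - y)) g ∧ (∀ k, k ≤ x → g k = f k) ∧ g (x + 1) = d ∧
      ∀ k, g (x + 2 + k) = f (y + k) := by
  have h1 : H.OpenSeq Z 0 (fun _ => d) := ⟨fun k hk => by omega, fun k hk => by omega⟩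
  have h2 := h1.glue (h.drop y) (by simpa using hy.symm) (by simp) (fun hy' => hyo (by omega))
  have h3 := (h.take hxn).glue h2 (by simpa using hx) (by simpa using hxo)
    (fun _ => .inl (by simpa using ⟨hdx, hdy, hd⟩))
  refine ⟨_, by rwa [show x + 1 + (0 + 1 + (n - y)) = x + 2 + (n - y) by omega] at h3,
    fun k hk => by simp [hk], by simp, fun k => ?_⟩
  simp [show ¬ x + 2 + k ≤ x by omega, show x + 2 + k - (x + 1) = k + 1 by omega]

namespace Similar

variable {Z : Set V} {n : ℕ} {f : ℕ → V}

/-- Only the first edge, from `f i` to `d`, needs care. If the search on either side ends at a node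
not adjacent to `d`, the resulting path or triple orients this edge in `H₂`; if both sides can be
joined to `d`, a detour through `d` contradicts minimality. -/
theorem mem_ancSet (h : Similar H₁ H₂) (hf : H₁.IsShortest Z n f)
    (hmin : ∀ g, H₁.OpenSeq Z n g → g 0 = f 0 → g n = f n →
      ∑ k ∈ Finset.range n, H₁.ancDist Z (f k) ≤ ∑ k ∈ Finset.range n, H₁.ancDist Z (g k))
    {i : ℕ} (hi : 0 < i) (hin : i < n) (hl : ¬ H₁.Ant (f i) (f (i - 1)))
    (hr : ¬ H₁.Ant (f i) (f (i + 1))) : f i ∈ H₂.AncSet Z := by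
  have hA : f i ∈ H₁.AncSet Z := by
    rcases hf.1.triple hi hin with h' | h'
    · exact h'.2.2
    · tauto
  have hsame := fun {k} hk hkn => h.sameAt hf (i := k) hk hkn
  have hi2 := (hsame hi hin).1 ⟨hl, hr⟩
  have hreach : H₁.Reaches Z (H₁.ancDist Z (f i)) (f i) := Nat.sInf_mem (mem_ancSet_iff.1 hA)
  obtain hm | ⟨m, hm⟩ : H₁.ancDist Z (f i) = 0 ∨ ∃ m, H₁.ancDist Z (f i) = m + 1 :=
    (Nat.eq_zero_or_pos _).imp_right fun h => ⟨_, (Nat.succ_pred_eq_of_pos h).symm⟩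
  · rw [hm] at hreach
    exact mem_ancSet_of_mem hreach
  rw [hm] at hreach
  obtain ⟨d, hid, hd⟩ := hreach
  have hid' := h.left.directed_iff.1 hid
  have hnr : ¬ H₁.Reaches Z m (f i) := fun h' => by
    have : H₁.ancDist Z (f i) ≤ m := Nat.sInf_le h'
    omega
  suffices hid2 : H₂.Directed (f i) d from
    mem_ancSet_of_directed hid2 (h.mem_ancSet_of_reaches hd hnr hid hid2)
  obtain ⟨x, hx, hx1, hx2⟩ := hf.1.exists_parentColliders h.left hi hin.le hl hid'.2.1
  obtain ⟨y', hy, hy1, hy2⟩ := hf.reverse.1.exists_parentColliders h.left (j := n - i) (w := d)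
    (by omega) (by omega)
    (by simpa only [show n - (n - i) = i by omega, show n - (n - i - 1) = i + 1 by omega])
    (by simpa only [show n - (n - i) = i by omega] using hid'.2.1)
  rcases hx2 with hx2 | hx2
  · exact h.directed_of_parentColliders hf hx hin.le hid hl hx2 hx1 (fun k hk hki =>
      (hsame (by omega) (by omega)).1 ⟨(hx1 k hk hki).1, (hx1 k hk hki).2.1⟩) hi2.1
  rcases hy2 with hy2 | hy2
  · have := h.directed_of_parentColliders hf.reverse (i := n - i) (w := d) hy (by omega)
      (by simpa only [show n - (n - i) = i by omega])
      (by simpa only [show n - (n - i) = i by omega, show n - (n - i - 1) = i + 1 by omega])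
      hy2 hy1 (fun k hk hki => ?_)
      (by simpa only [show n - (n - i) = i by omega, show n - (n - i - 1) = i + 1 by omega]
        using hi2.2)
    · simpa only [show n - (n - i) = i by omega] using this
    · have h1 := hy1 k hk hki
      have h2 := hsame (k := n - k) (by omega) (by omega)
      simp only [show n - (k - 1) = n - k + 1 by omega, show n - (k + 1) = n - k - 1 by omega] at h1 ⊢
      exact (h2.1 ⟨h1.2.1, h1.1⟩).symm
  exfalso
  obtain ⟨y, hyn, rfl⟩ : ∃ y, y ≤ n ∧ y' = n - y := ⟨n - y', by omega, by omega⟩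
  simp only [show n - (n - y) = y by omega] at hy2
  obtain ⟨g, hg, g1, g2, g3⟩ := hf.1.exists_detour (x := x) (y := y) (d := d) (by omega) hx2.1
    hx2.2.1 hx2.2.2 hy2.1 hy2.2.1
    (fun hy' => by
      have := (hy2.2.2 (by omega)).symm
      rwa [show n - (n - y - 1) = y + 1 by omega] at this) (mem_ancSet_iff.2 ⟨m, hd⟩)
  have g0 : g 0 = f 0 := g1 0 (by omega)
  have gn : g (x + 2 + (n - y)) = f n := by rw [g3, show y + (n - y) = n by omega]
  have := hf.2 _ _ hg g0 gn
  -- The detour has at least `n` edges and `x < i < y`, so it replaces exactly the node `f i` by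
  -- `d`, which is closer to `Z`.
  obtain rfl : y = x + 2 := by omega
  obtain rfl : i = x + 1 := by omega
  rw [show x + 2 + (n - (x + 2)) = n by omega] at hg gn
  have hgf : ∀ k, k ≠ x + 1 → g k = f k := by
    intro k hk
    by_cases hk' : k ≤ x
    · exact g1 k hk'
    · have := g3 (k - (x + 2))
      rwa [show x + 2 + (k - (x + 2)) = k by omega] at this
  have hlt : H₁.ancDist Z d < H₁.ancDist Z (f (x + 1)) := by
    have : H₁.ancDist Z d ≤ m := Nat.sInf_le hd
    omega
  refine absurd (hmin g hg g0 gn) (not_le.2 (Finset.sum_lt_sum (fun k _ => ?_)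
    ⟨x + 1, Finset.mem_range.2 hin, by rwa [g2]⟩))
  by_cases hk : k = x + 1
  · rw [hk, g2]
    exact hlt.le
  · rw [hgf k hk]

/-- With colliders settled, only an arrowhead at an undirected edge could block. σ-completeness
would then shield the position, and the discriminating path, valid in `H₂` too, excludes such marks.
-/
theorem openSeq (h : Similar H₁ H₂) (hf : H₁.IsShortest Z n f)
    (hmin : ∀ g, H₁.OpenSeq Z n g → g 0 = f 0 → g n = f n →
      ∑ k ∈ Finset.range n, H₁.ancDist Z (f k) ≤ ∑ k ∈ Finset.range n, H₁.ancDist Z (g k)) :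
    H₂.OpenSeq Z n f := by
  refine ⟨fun k hk => (h.adj _ _).1 (hf.1.1 k hk), fun k hk => ?_⟩
  have hs : SameAt H₁ H₂ f (k + 1) := h.sameAt hf (by omega) hk
  have ha : _ → _ → f (k + 1) ∈ H₂.AncSet Z := h.mem_ancSet hf hmin (by omega) hk
  have t := hf.1.2 k hk
  have a0 := hf.1.1 k (by omega)
  have a1 := hf.1.1 (k + 1) hk
  have hdisc : H₁.Adj (f k) (f (k + 2)) →
      (H₂.Directed (f k) (f (k + 2)) ∧ ¬ H₂.Ant (f k) (f (k + 1))) ∨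
      (H₂.Directed (f (k + 2)) (f k) ∧ ¬ H₂.Ant (f (k + 2)) (f (k + 1))) := by
    intro hadj
    rcases hf.discriminated h.left (i := k + 1) (by omega) hk hadj with ⟨x, hx⟩ | ⟨y, hyn, hy⟩
    · have h1 := hx.1
      obtain ⟨-, h2, -, h3⟩ := h.discriminatedLeft hf hk hx
        (fun k hk hki => h.sameAt hf (by omega) (by omega))
      have := h3 k (by omega) (by omega)
      exact .inl ⟨this.2.2, this.2.1⟩
    · have h1 := hy.1
      obtain ⟨-, h2, -, h3⟩ := h.discriminatedRight hf (by omega) hyn hy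
        (fun k hk hki => h.sameAt hf (by omega) (by omega))
      have := h3 (k + 2) (by omega) (by omega)
      exact .inr ⟨this.2.2, this.1⟩
  have n1 : ¬ H₂.Ant (f (k + 1)) (f (k + 2)) → H₂.Ant (f (k + 1)) (f k) →
      H₂.Ant (f k) (f (k + 1)) → False := by
    intro h1 h2 h3
    have hadj := h.right.adj_of_into ((h.adj _ _).1 a1).symm h1 ((h.adj _ _).1 a0).symm h2 h3
    rcases hdisc ((h.adj _ _).2 hadj.symm) with h4 | h4
    · exact h4.2 h3
    · exact h4.2 ((h.right.directed_iff.1 h4.1).2.1.trans h3)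
  have n2 : ¬ H₂.Ant (f (k + 1)) (f k) → H₂.Ant (f (k + 1)) (f (k + 2)) →
      H₂.Ant (f (k + 2)) (f (k + 1)) → False := by
    intro h1 h2 h3
    have hadj := h.right.adj_of_into ((h.adj _ _).1 a0) h1 ((h.adj _ _).1 a1) h2 h3
    rcases hdisc ((h.adj _ _).2 hadj) with h4 | h4
    · exact h4.2 ((h.right.directed_iff.1 h4.1).2.1.trans h3)
    · exact h4.2 h3
  simp only [SameAt, Nat.add_sub_cancel, add_assoc, Nat.reduceAdd] at hs ha
  clear hmin hdisc
  unfold TripleOpen at *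
  grind

theorem mSeparated (h : Similar H₁ H₂) {X Y : Set V} (hsep : H₂.MSeparated X Y Z) :
    H₁.MSeparated X Y Z := by
  classical
  rw [h.left.mSeparated_iff]
  rw [h.right.mSeparated_iff] at hsep
  intro n f hf h0 hn hZ
  have hex : ∃ m g, H₁.OpenSeq Z m g ∧ g 0 = f 0 ∧ g m = f n := ⟨n, f, hf, rfl, rfl⟩
  -- Two successive minimisations: first the length, then the sum of distances among walks of that
  -- length.
  have hex' : ∃ s g, H₁.OpenSeq Z (Nat.find hex) g ∧ g 0 = f 0 ∧ g (Nat.find hex) = f n ∧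
      ∑ k ∈ Finset.range (Nat.find hex), H₁.ancDist Z (g k) = s := by
    obtain ⟨g, h1, h2, h3⟩ := Nat.find_spec hex
    exact ⟨_, g, h1, h2, h3, rfl⟩
  obtain ⟨g, h1, h2, h3, h4⟩ := Nat.find_spec hex'
  have := h.openSeq ⟨h1, fun m g' k1 k2 k3 => Nat.find_min' hex
    ⟨g', k1, k2.trans h2, k3.trans h3⟩⟩ (fun g' k1 k2 k3 => by
      rw [h4]
      exact Nat.find_min' hex' ⟨g', k1, k2.trans h2, k3.trans h3, rfl⟩)
  rw [← h3]
  exact hsep _ g this (by rwa [h2]) (by rwa [h3]) (by rwa [h2])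

theorem symm (h : Similar H₁ H₂) : Similar H₂ H₁ :=
  ⟨h.right, h.left, h.adj.symm, h.unshielded.symm, h.discriminated.symm⟩

theorem mMarkovEquivalent (h : Similar H₁ H₂) : H₁.MMarkovEquivalent H₂ :=
  fun _ _ _ => ⟨h.symm.mSeparated, h.mSeparated⟩

end Similar

end MixedGraph

theorem mainTheorem3 {V : Type*} (H₁ H₂ : MixedGraph V)
    (h₁ : H₁.IsSigmaMAG) (h₂ : H₂.IsSigmaMAG) :
    H₁.MMarkovEquivalent H₂ ↔
      H₁.SameAdjacencies H₂ ∧ H₁.SameUnshieldedColliders H₂ ∧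
        H₁.SameDiscriminatedColliders H₂ := by
  refine ⟨fun h => ⟨h.sameAdjacencies h₁ h₂, fun a b c => ⟨h.isUnshieldedCollider h₁ h₂,
    h.symm.isUnshieldedCollider h₂ h₁⟩, h.sameDiscriminatedColliders h₁ h₂⟩, fun h => ?_⟩
  exact MixedGraph.Similar.mMarkovEquivalent ⟨h₁, h₂, h.1, h.2.1, h.2.2⟩
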